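/- Let $H$ be an infinite-dimensional real separable Hilbert space, and let $A:D(A)\subset H\to H$ be a self-adjoint operator such that, for some $\omega>0$, $\langle Ax,x\rangle\le-\omega|x|_H^2$ for all $x\in D(A)$, and such that $A^{-1}$ is of trace class. Let $(e_k)_{k\ge1}$ be an orthonormal basis of $H$ with $Ae_k=-\lambda_ke_k$ (such a basis exists), so that $e^{tA}e_k=e^{-\lambda_kt}e_k$. For $t\ge0$ put $$Q_t=\int_0^te^{2rA}\,dr,\qquad \Gamma_tz=(-A)^{1/2}\int_0^te^{rA}z\,dr=\sum_{k\ge1}\frac{1-e^{-\lambda_kt}}{\lambda_k^{1/2}}\langle z,e_k\rangle e_k ,$$ let $N(0,Q_t)$ be the centred Gaussian measure on $H$ with covariance operator $Q_t$, and for $z,x\in H$ define $$P^{(z)}_tg(x)=\int_Hg\big(e^{tA}x+y+\Gamma_tz\big)\,N(0,Q_t)(dy)$$ for bounded Borel functions $g$ on $H$ with values in $\mathbb R$ or in $H$. For a bounded Borel function $f:H\to\mathbb R$, $\lambda>0$ and $z\in H$ let $$u^{(z)}(x)=\int_0^\infty e^{-\lambda t}P^{(z)}_tf(x)\,dt,\qquad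 x\in H,$$ and let $\|f\|_0=\sup_{x\in H}|f(x)|$. Put $$C_1=\sqrt2\,\sup_{u>0}\frac{u\,e^{-u^2}}{(1-e^{-2u^2})^{1/2}},\qquad C_2=\sqrt2\,\pi\,\frac{(1+\omega)^{1/2}}{\omega^{1/2}}+4C_1 .$$ Then the integral defining $u^{(z)}(x)$ converges absolutely for every $x\in H$; the function $u^{(z)}$ is bounded and continuously Fréchet differentiable on $H$ with bounded gradient $Du^{(z)}:H\to H$; and for all $s\in[0,1]$ and $x\in H$, $$\big|P^{(z)}_s Du^{(z)}(x)-Du^{(z)}(x)\big|_H\le C_2\,s^{1/2}\,\|f\|_0 .$$ -/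

import Mathlib

open MeasureTheory ProbabilityTheory Filter Topology Set TopologicalSpace

noncomputable section

namespace OU

section Definitions

variable {H : Type*} [NormedAddCommGroup H] [InnerProductSpace ℝ H]

/-- A bounded operator on a Hilbert space is trace class (nuclear) if `T x = ∑ₙ ⟪aₙ, x⟫ bₙ` with
`∑ₙ ‖aₙ‖ ‖bₙ‖ < ∞`. -/
def IsTraceClass (T : H →L[ℝ] H) : Prop :=
  ∃ a b : ℕ → H, Summable (fun n => ‖a n‖ * ‖b n‖) ∧
    ∀ x, HasSum (fun n => inner ℝ (a n) x • b n) (T x)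

/-- `A : D(A) ⊂ H → H` is self-adjoint (in particular densely defined), `⟪A x, x⟫ ≤ -ω ‖x‖²` on
`D(A)` with `ω > 0`, and `A` has a trace class inverse `A⁻¹ : H → D(A)`. -/
structure IsNegTraceClassInv [CompleteSpace H] (A : H →ₗ.[ℝ] H) (ω : ℝ) : Prop where
  pos : 0 < ω
  selfAdjoint : IsSelfAdjoint A
  neg : ∀ x : A.domain, inner ℝ (A x) (x : H) ≤ -ω * ‖(x : H)‖ ^ 2
  traceClass_inv : ∃ G : H →L[ℝ] H, IsTraceClass G ∧
    (∀ y : H, ∃ hy : G y ∈ A.domain, A ⟨G y, hy⟩ = y) ∧ ∀ x : A.domain, G (A x) = x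

/-- `e` is an orthonormal basis of eigenvectors of `A`, with `A eₖ = -lamₖ eₖ`. -/
def IsEigenbasis (A : H →ₗ.[ℝ] H) (e : HilbertBasis ℕ ℝ H) (lam : ℕ → ℝ) : Prop :=
  ∀ k, ∃ hk : e k ∈ A.domain, A ⟨e k, hk⟩ = -lam k • e k

end Definitions

section Eigenbasis

variable {H : Type*} [NormedAddCommGroup H] [InnerProductSpace ℝ H]

theorem IsTraceClass.isCompactOperator [CompleteSpace H] {T : H →L[ℝ] H} (hT : IsTraceClass T) :
    IsCompactOperator T := by
  obtain ⟨a, b, hs, hab⟩ := hT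
  set g : ℕ → H →L[ℝ] H := fun n => (innerSL ℝ (a n)).smulRight (b n) with hg
  have hgs : Summable g := by
    refine Summable.of_norm ?_
    simpa [hg, ContinuousLinearMap.norm_smulRight_apply] using hs
  have hTg : T = ∑' n, g n := by
    ext x
    have h1 := (ContinuousLinearMap.apply ℝ H x).hasSum hgs.hasSum
    exact (hab x).unique (by simpa [hg] using h1)
  have hlim := hgs.hasSum.tendsto_sum_nat
  rw [← hTg] at hlim
  refine isCompactOperator_of_tendsto hlim (Eventually.of_forall fun N => ?_)
  have hmem : ∑ n ∈ Finset.range N, g n ∈ compactOperator (RingHom.id ℝ) H H := by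
    refine Submodule.sum_mem _ fun n _ => ?_
    have h2 : IsCompactOperator (innerSL ℝ (a n)) :=
      (isCompactOperator_id (E := ℝ)).comp_clm (innerSL ℝ (a n))
    exact h2.clm_comp (ContinuousLinearMap.toSpanSingleton ℝ (b n))
  exact hmem

theorem countable_of_orthonormal [SeparableSpace H] {ι : Type*} {v : ι → H}
    (hv : Orthonormal ℝ v) : Countable ι := by
  have hd : (univ : Set ι).PairwiseDisjoint fun i => Metric.ball (v i) (1 / 2) := by
    intro i _ j _ hij
    refine Metric.ball_disjoint_ball ?_
    have h : ‖v i - v j‖ ^ 2 = 2 := by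
      rw [norm_sub_sq_real, hv.1 i, hv.1 j, hv.2 hij]; norm_num
    rw [dist_eq_norm]
    nlinarith [norm_nonneg (v i - v j)]
  have := hd.countable_of_isOpen (fun i _ => Metric.isOpen_ball)
    (fun i _ => Metric.nonempty_ball.2 (by norm_num))
  exact countable_univ_iff.1 this

/-- A compact symmetric operator on an infinite dimensional separable Hilbert space has an
orthonormal basis of eigenvectors, indexed by `ℕ`. -/
theorem exists_hilbertBasis_eigenvectors [CompleteSpace H] [SeparableSpace H]
    (hH : ¬ FiniteDimensional ℝ H) (T : H →L[ℝ] H) (hc : IsCompactOperator T)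
    (hs : (T : H →ₗ[ℝ] H).IsSymmetric) :
    ∃ (e : HilbertBasis ℕ ℝ H) (m : ℕ → ℝ), ∀ k, T (e k) = m k • e k := by
  classical
  set V : ℝ → Submodule ℝ H := fun μ => Module.End.eigenspace (T : H →ₗ[ℝ] H) μ with hV
  have hclosed : ∀ μ, IsClosed (V μ : Set H) := by
    intro μ
    have : (V μ : Set H) = {x | T x = μ • x} := by
      ext x; simp [hV]
    rw [this]
    exact isClosed_eq T.continuous (continuous_const_smul μ)
  have : ∀ μ, CompleteSpace (V μ) := fun μ => (hclosed μ).completeSpace_coe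
  choose w b hb using fun μ => exists_hilbertBasis (𝕜 := ℝ) (E := V μ)
  have hon : Orthonormal ℝ fun i : Σ μ, w μ => ((b i.1 i.2 : V i.1) : H) :=
    hs.orthogonalFamily_eigenspaces.orthonormal_sigma_orthonormal
      (v_family := fun μ => b μ) (fun μ => (b μ).orthonormal)
  set v : (Σ μ, w μ) → H := fun i => ((b i.1 i.2 : V i.1) : H) with hv
  have hperp : (Submodule.span ℝ (range v))ᗮ = ⊥ := by
    rw [eq_bot_iff, ← T.orthogonalComplement_iSup_eigenspaces_eq_bot hc hs]
    intro x hx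
    rw [Submodule.mem_orthogonal'] at hx
    rw [← Submodule.iInf_orthogonal, Submodule.mem_iInf]
    intro μ
    rw [Submodule.mem_orthogonal']
    intro y hy
    have h0 : (innerSL ℝ x).comp (V μ).subtypeL = 0 := by
      refine ContinuousLinearMap.ext_on (s := range (b μ)) ?_ ?_
      · rw [dense_iff_closure_eq, ← Submodule.topologicalClosure_coe, (b μ).dense_span]; rfl
      · rintro _ ⟨i, rfl⟩
        simpa using hx _ (Submodule.subset_span ⟨⟨μ, i⟩, rfl⟩)
    simpa using congrArg (fun L => L ⟨y, hy⟩) h0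
  have hcount : Countable (Σ μ, w μ) := countable_of_orthonormal hon
  have hinf : Infinite (Σ μ, w μ) := by
    by_contra hfin
    rw [not_infinite_iff_finite] at hfin
    have := Fintype.ofFinite (Σ μ, w μ)
    exact hH (((HilbertBasis.mkOfOrthogonalEqBot hon hperp).toOrthonormalBasis
      ).toBasis.finiteDimensional_of_finite)
  obtain ⟨q⟩ := nonempty_equiv_of_countable (α := ℕ) (β := Σ μ, w μ)
  have hon' : Orthonormal ℝ (v ∘ q) := hon.comp q q.injective
  have hperp' : (Submodule.span ℝ (range (v ∘ q)))ᗮ = ⊥ := by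
    rw [q.surjective.range_comp]; exact hperp
  refine ⟨HilbertBasis.mkOfOrthogonalEqBot hon' hperp', fun k => (q k).1, fun k => ?_⟩
  rw [HilbertBasis.coe_mkOfOrthogonalEqBot]
  exact Module.End.mem_eigenspace_iff.1 (b (q k).1 (q k).2 : V (q k).1).2

/-- Under the hypotheses on `A`, an orthonormal basis of eigenvectors exists. -/
theorem IsNegTraceClassInv.exists_isEigenbasis [CompleteSpace H] [SeparableSpace H]
    (hH : ¬ FiniteDimensional ℝ H) {A : H →ₗ.[ℝ] H} {ω : ℝ} (hA : IsNegTraceClassInv A ω) :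
    ∃ (e : HilbertBasis ℕ ℝ H) (lam : ℕ → ℝ), IsEigenbasis A e lam := by
  obtain ⟨G, hG, hGr, hGl⟩ := hA.traceClass_inv
  have hsymA : ∀ x y : A.domain, inner ℝ (A x) (y : H) = inner ℝ (x : H) (A y) := by
    have h := LinearPMap.adjoint_isFormalAdjoint hA.selfAdjoint.dense_domain
    rw [LinearPMap.isSelfAdjoint_def.1 hA.selfAdjoint] at h
    exact fun x y => h x y
  have hs : (G : H →ₗ[ℝ] H).IsSymmetric := by
    intro x y
    obtain ⟨hx, hx'⟩ := hGr x
    obtain ⟨hy, hy'⟩ := hGr y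
    have h := hsymA ⟨G x, hx⟩ ⟨G y, hy⟩
    rw [hx', hy'] at h
    exact h.symm
  obtain ⟨e, m, hem⟩ := exists_hilbertBasis_eigenvectors hH G hG.isCompactOperator hs
  refine ⟨e, fun k => -(m k)⁻¹, fun k => ?_⟩
  obtain ⟨hk, hk'⟩ := hGr (e k)
  have hne : e k ≠ 0 := e.orthonormal.ne_zero k
  have hm : m k ≠ 0 := by
    intro h0
    have hz : (⟨G (e k), hk⟩ : A.domain) = 0 := Subtype.ext (by simp [hem, h0])
    rw [hz, LinearPMap.map_zero] at hk'
    exact hne hk'.symm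
  have hek : e k = (m k)⁻¹ • G (e k) := by rw [hem, smul_smul, inv_mul_cancel₀ hm, one_smul]
  have hd : e k ∈ A.domain := by rw [hek]; exact A.domain.smul_mem _ hk
  refine ⟨hd, ?_⟩
  have hsub : (⟨e k, hd⟩ : A.domain) = (m k)⁻¹ • ⟨G (e k), hk⟩ := Subtype.ext hek
  rw [hsub, LinearPMap.map_smul, hk', neg_neg]

end Eigenbasis

section Operators

variable {H : Type*} [NormedAddCommGroup H] [InnerProductSpace ℝ H]

/-- The diagonal operator `x ↦ ∑ₖ mₖ ⟪eₖ, x⟫ eₖ`. It is used for bounded `m` only. -/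
def diagOp (e : HilbertBasis ℕ ℝ H) (m : ℕ → ℝ) (x : H) : H :=
  ∑' k, (m k * inner ℝ (e k) x) • e k

/-- The semigroup `e^{tA}`, `e^{tA} eₖ = e^{-lamₖ t} eₖ`. -/
def semigroup (e : HilbertBasis ℕ ℝ H) (lam : ℕ → ℝ) (t : ℝ) : H → H :=
  diagOp e fun k => Real.exp (-lam k * t)

/-- `Γ_t = (-A)^{1/2} ∫₀ᵗ e^{sA} ds`, which acts on `eₖ` by
`lamₖ^{1/2} (1 - e^{-lamₖ t}) / lamₖ = (1 - e^{-lamₖ t}) / lamₖ^{1/2}`. -/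
def drift (e : HilbertBasis ℕ ℝ H) (lam : ℕ → ℝ) (t : ℝ) : H → H :=
  diagOp e fun k => (1 - Real.exp (-lam k * t)) / √(lam k)

/-- The eigenvalue `∫₀ᵗ e^{-2 lamₖ s} ds = (1 - e^{-2 lamₖ t}) / (2 lamₖ)` of the covariance
operator `Q_t = ∫₀ᵗ e^{2sA} ds` on `eₖ`. -/
def covEigenvalue (lam : ℕ → ℝ) (t : ℝ) (k : ℕ) : ℝ :=
  (1 - Real.exp (-2 * lam k * t)) / (2 * lam k)

end Operators

section GaussianDef

variable {H : Type*} [NormedAddCommGroup H] [InnerProductSpace ℝ H]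

variable [MeasurableSpace H]

/-- The centred Gaussian measure `N(0, Q)` on `H` whose covariance operator `Q` is the trace class
operator with `Q eₖ = qₖ eₖ`, `qₖ ≥ 0`, `∑ₖ qₖ < ∞`: the law of the almost surely convergent series
`∑ₖ ξₖ eₖ`, where the `ξₖ` are independent with laws `N(0, qₖ)`. -/
def gaussianMeasure (e : HilbertBasis ℕ ℝ H) (q : ℕ → ℝ) : Measure H :=
  (Measure.infinitePi fun k => gaussianReal 0 (q k).toNNReal).map fun y : ℕ → ℝ => ∑' k, y k • e k

end GaussianDef

section Gaussian

variable {H : Type*} [NormedAddCommGroup H] [InnerProductSpace ℝ H] [CompleteSpace H]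

theorem summable_smul_basis_iff (e : HilbertBasis ℕ ℝ H) (y : ℕ → ℝ) :
    Summable (fun k => y k • e k) ↔ Summable fun k => y k ^ 2 := by
  have h := e.orthonormal.orthogonalFamily.summable_iff_norm_sq_summable y
  simpa using h

theorem ae_summable_smul_basis (e : HilbertBasis ℕ ℝ H) (q : ℕ → ℝ) (hq : ∀ k, 0 ≤ q k)
    (hs : Summable q) :
    ∀ᵐ y : ℕ → ℝ ∂(Measure.infinitePi fun k => gaussianReal 0 (q k).toNNReal),
      Summable fun k => y k • e k := by
  set ν := Measure.infinitePi fun k => gaussianReal 0 (q k).toNNReal with hν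
  have hk : ∀ k, ∫⁻ y : ℕ → ℝ, ENNReal.ofReal (y k ^ 2) ∂ν = ENNReal.ofReal (q k) := by
    intro k
    have h1 := (measurePreserving_eval_infinitePi
      (fun k => gaussianReal 0 (q k).toNNReal) k).lintegral_comp
      (f := fun x : ℝ => ENNReal.ofReal (x ^ 2)) (by fun_prop : Measurable _)
    simp only [Function.eval] at h1
    rw [h1, ← ofReal_integral_eq_lintegral_ofReal]
    · have h2 := variance_fun_id_gaussianReal (μ := 0) (v := (q k).toNNReal)
      rw [variance_eq_integral (by fun_prop)] at h2
      simp only [integral_id_gaussianReal, sub_zero] at h2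
      rw [h2, Real.coe_toNNReal _ (hq k)]
    · exact (memLp_id_gaussianReal 2).integrable_sq
    · exact Eventually.of_forall fun x => sq_nonneg x
  have hfin : ∫⁻ y : ℕ → ℝ, ∑' k, ENNReal.ofReal (y k ^ 2) ∂ν ≠ ⊤ := by
    rw [lintegral_tsum (fun k => (by fun_prop : Measurable _).aemeasurable)]
    simp_rw [hk]
    exact hs.tsum_ofReal_ne_top
  filter_upwards [ae_lt_top (by fun_prop) hfin] with y hy
  rw [summable_smul_basis_iff]
  have := ENNReal.summable_toReal hy.ne
  simpa [ENNReal.toReal_ofReal (sq_nonneg _)] using this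

theorem measurable_tsum_smul_basis [MeasurableSpace H] [BorelSpace H] (e : HilbertBasis ℕ ℝ H) :
    Measurable fun y : ℕ → ℝ => ∑' k, y k • e k := by
  classical
  set S : Set (ℕ → ℝ) := {y | ∑' k, ENNReal.ofReal (y k ^ 2) < ⊤} with hS
  have hSm : MeasurableSet S := measurableSet_lt (by fun_prop) measurable_const
  have hSiff : ∀ y, y ∈ S ↔ Summable fun k => y k • e k := by
    intro y
    rw [summable_smul_basis_iff]
    constructor
    · intro hy
      have := ENNReal.summable_toReal (ne_of_lt hy)
      simpa [ENNReal.toReal_ofReal (sq_nonneg _)] using this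
    · intro hy
      exact lt_top_iff_ne_top.2 hy.tsum_ofReal_ne_top
  refine measurable_of_tendsto_metrizable (f := fun N => S.indicator
    fun y : ℕ → ℝ => ∑ k ∈ Finset.range N, y k • e k) (fun N => ?_) ?_
  · refine Measurable.indicator ?_ hSm
    have : Continuous fun y : ℕ → ℝ => ∑ k ∈ Finset.range N, y k • e k := by fun_prop
    exact this.measurable
  · rw [tendsto_pi_nhds]
    intro y
    by_cases hy : y ∈ S
    · simpa [hy] using ((hSiff y).1 hy).hasSum.tendsto_sum_nat
    · simp [hy, tsum_eq_zero_of_not_summable (mt (hSiff y).2 hy)]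

/-- The measure `gaussianMeasure e q` has the characteristic function of the centred Gaussian
measure whose covariance operator has eigenvalue `qₖ` on `eₖ`. -/
theorem charFun_gaussianMeasure [MeasurableSpace H] [BorelSpace H] (e : HilbertBasis ℕ ℝ H)
    (q : ℕ → ℝ) (hq : ∀ k, 0 ≤ q k) (hs : Summable q) (h : H) :
    charFun (gaussianMeasure e q) h
      = Complex.exp (-((∑' k, q k * inner ℝ (e k) h ^ 2 : ℝ) : ℂ) / 2) := by
  set ν := Measure.infinitePi fun k => gaussianReal 0 (q k).toNNReal with hν
  set c : ℕ → ℝ := fun k => inner ℝ (e k) h with hc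
  have hae : ∀ᵐ y ∂ν, Summable fun k => y k • e k := ae_summable_smul_basis e q hq hs
  have hfin : ∀ N, ∫ y, Complex.exp ((∑ k ∈ Finset.range N, c k * y k : ℝ) * Complex.I) ∂ν
      = Complex.exp (-((∑ k ∈ Finset.range N, q k * c k ^ 2 : ℝ) : ℂ) / 2) := by
    intro N
    have hind : iIndepFun (fun (k : ℕ) (y : ℕ → ℝ) => c k * y k) ν :=
      iIndepFun_infinitePi (X := fun k x => c k * x) (fun k => by fun_prop)
    have hm : ∀ k, Measurable fun y : ℕ → ℝ => c k * y k := fun k =>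
      (measurable_pi_apply k : Measurable fun y : ℕ → ℝ => y k).const_mul (c k)
    have h1 := congrFun ((hind.restrict (Finset.range N)).charFun_map_fun_finsetSum_eq_prod
      (fun k _ => (hm k).aemeasurable)) 1
    rw [charFun_apply_real, integral_map
      (Finset.measurable_fun_sum _ fun k _ => hm k).aemeasurable (by fun_prop)] at h1
    simp only [Complex.ofReal_one, one_mul, Finset.prod_apply] at h1
    rw [h1]
    have h2 : ∀ k, charFun (ν.map fun y : ℕ → ℝ => c k * y k) 1
        = Complex.exp (-((q k * c k ^ 2 : ℝ) : ℂ) / 2) := by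
      intro k
      have h3 : (ν.map fun y : ℕ → ℝ => y k) = gaussianReal 0 (q k).toNNReal :=
        (measurePreserving_eval_infinitePi (fun k => gaussianReal 0 (q k).toNNReal) k).map_eq
      rw [charFun_map_mul_comp (measurable_pi_apply k).aemeasurable, h3, charFun_gaussianReal]
      congr 1
      have h5 : (((q k).toNNReal : ℝ) : ℂ) = (q k : ℂ) := by rw [Real.coe_toNNReal _ (hq k)]
      rw [h5]
      push_cast
      ring
    rw [Finset.prod_congr rfl fun k _ => h2 k, ← Complex.exp_sum]
    congr 1
    push_cast
    rw [← Finset.sum_div, Finset.sum_neg_distrib]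
  have hconv : Tendsto (fun N => Complex.exp (-((∑ k ∈ Finset.range N, q k * c k ^ 2 : ℝ) : ℂ) / 2))
      atTop (𝓝 (Complex.exp (-((∑' k, q k * c k ^ 2 : ℝ) : ℂ) / 2))) := by
    have hsum : Summable fun k => q k * c k ^ 2 := by
      refine Summable.of_nonneg_of_le (fun k => mul_nonneg (hq k) (sq_nonneg _)) (fun k => ?_)
        (hs.mul_right (‖h‖ ^ 2))
      refine mul_le_mul_of_nonneg_left ?_ (hq k)
      have h2 := abs_real_inner_le_norm (e k) h
      rw [e.orthonormal.1 k, one_mul] at h2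
      exact sq_le_sq' (by linarith [neg_abs_le (c k)]) ((le_abs_self _).trans h2)
    have hcont : Continuous fun r : ℝ => Complex.exp (-(r : ℂ) / 2) := by fun_prop
    exact (hcont.tendsto _).comp hsum.hasSum.tendsto_sum_nat
  rw [charFun_apply, gaussianMeasure, integral_map (measurable_tsum_smul_basis e).aemeasurable
    (by have : Continuous fun x : H => Complex.exp ((inner ℝ x h : ℝ) * Complex.I) := by fun_prop
        exact this.stronglyMeasurable.aestronglyMeasurable)]
  refine tendsto_nhds_unique ?_ hconv
  simp_rw [← hfin]
  refine tendsto_integral_of_dominated_convergence (fun _ => (1 : ℝ)) (fun N => ?_)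
    (integrable_const _) (fun N => ?_) ?_
  · have : Continuous fun y : ℕ → ℝ =>
        Complex.exp ((∑ k ∈ Finset.range N, c k * y k : ℝ) * Complex.I) := by fun_prop
    exact this.aestronglyMeasurable
  · exact Eventually.of_forall fun y => (Complex.norm_exp_ofReal_mul_I _).le
  · filter_upwards [hae] with y hy
    have h3 := hy.hasSum.mapL (innerSL ℝ h)
    have h4 : HasSum (fun k => c k * y k) (inner ℝ (∑' k, y k • e k) h) := by
      rw [real_inner_comm]
      simpa [hc, real_inner_comm, inner_smul_right, mul_comm] using h3
    have hcont : Continuous fun r : ℝ => Complex.exp ((r : ℂ) * Complex.I) := by fun_prop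
    exact (hcont.tendsto _).comp h4.tendsto_sum_nat

end Gaussian

section Semigroup

variable {H : Type*} [NormedAddCommGroup H] [InnerProductSpace ℝ H]

variable [MeasurableSpace H]

/-- The generalised Ornstein-Uhlenbeck semigroup
`P_t^{(z)} f(x) = ∫ f(e^{tA} x + y + Γ_t z) N(0, Q_t)(dy)`, for functions `f` with values in `E`. -/
def P {E : Type*} [NormedAddCommGroup E] [NormedSpace ℝ E] (e : HilbertBasis ℕ ℝ H) (lam : ℕ → ℝ)
    (z : H) (t : ℝ) (f : H → E) (x : H) : E :=
  ∫ y, f (semigroup e lam t x + y + drift e lam t z) ∂(gaussianMeasure e (covEigenvalue lam t))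

/-- The resolvent `u^{(z)}(x) = ∫₀^∞ e^{-lt} P_t^{(z)} f(x) dt`. -/
def resolvent (e : HilbertBasis ℕ ℝ H) (lam : ℕ → ℝ) (z : H) (l : ℝ) (f : H → ℝ) (x : H) : ℝ :=
  ∫ t in Ioi (0 : ℝ), Real.exp (-l * t) * P e lam z t f x

/-- The supremum norm of a bounded function. -/
def supNorm (f : H → ℝ) : ℝ := ⨆ x, |f x|

/-- `C₁ = √2 sup_{u > 0} u e^{-u²} (1 - e^{-2u²})^{-1/2}`. -/
def C₁ : ℝ :=
  √2 * sSup ((fun u : ℝ => u * Real.exp (-u ^ 2) / √(1 - Real.exp (-2 * u ^ 2))) '' Ioi 0)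

/-- `C₂ = √2 π (1 + ω)^{1/2} / ω^{1/2} + 4 C₁`. -/
def C₂ (ω : ℝ) : ℝ := √2 * Real.pi * (√(1 + ω) / √ω) + 4 * C₁

end Semigroup

end OU

end

/-!
The drift is removed first: with `a = (-A)^{-1/2} z` one has `Γ_t z = a - e^{tA} a`, so that
`P_t^{(z)} f (x) = P_t^{(0)} f(· + a) (x - a)` (`OU.P_eq_transition`). This is why the constant does
not depend on `z`, and from here on `z = 0` and `M = sup |f|`.

For `t > 0`, `P_t f` is of class `C¹` although `f` is only Borel, because a shift of `x` by `k`
shifts the Gaussian variable by the Cameron-Martin vector `e^{tA} k = Q_t^{1/2} Λ_t k`, where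
`Λ_t = Q_t^{-1/2} e^{tA}` has norm at most `C₁ / √t`. The Gaussian measure carries a white noise
`W : H → L²` extending `Q^{1/2} h ↦ ⟪h, ·⟫` (`OU.exists_isWhiteNoise`), the shifted measure has the
density `exp (W g - ‖g‖² / 2)` (`OU.map_add_gaussianMeasure`, by comparison of characteristic
functions), and the distance in `L²` of this density from `1 + W g` is
`(e^{‖g‖²} - 1 - ‖g‖²)^{1/2} ≤ ‖g‖²` for `‖g‖ ≤ 1`. So `P_t f` has first order expansions with a
quadratic remainder uniform in `x`, which gives both the gradient `D P_t f (x) = Λ_t m` with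
`‖m‖ ≤ M`, and its continuity (`OU.exists_gradient_transition`). Since `C₁ / √t` is integrable at
zero, `Du = ∫₀^∞ e^{-lt} D P_t f dt`.

Differentiating `P_s P_t f = P_{s+t} f` gives `e^{sA} P_s D P_t f = D P_{t+s} f`. Hence

`P_s Du - Du = ∫₀^∞ e^{-lt} (P_s D P_t f - e^{-ls} D P_{t+s} f) dt - ∫₀^s e^{-lt} D P_t f dt`,

where `P_s D P_t f - D P_{t+s} f = (e^{-sA} - 1) Λ_{t+s} m`. No bound for `e^{-sA} - 1` alone is
available, nor is `D P_{t+s} f - D P_t f` small uniformly in `x`; but the product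
`(e^{-sA} - 1) Λ_{t+s}` is a bounded diagonal operator, of norm at most `√2 s / (√t (t + s))`
(`OU.one_sub_exp_mul_le`), and the integral of this over `t` is `√2 π √s`. The other two terms are
at most `C₁ √s M` and `2 C₁ √s M`, and `√2 π + 3 C₁ ≤ C₂`.
-/

namespace OU

/-! ### Hilbert bases and diagonal operators -/

section Basis

variable {H : Type*} [NormedAddCommGroup H] [InnerProductSpace ℝ H]

theorem separableSpace_of_hilbertBasis (e : HilbertBasis ℕ ℝ H) : SeparableSpace H := by
  rw [← isSeparable_univ_iff, ← Submodule.top_coe (R := ℝ) (M := H), ← e.dense_span]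
  exact ((countable_range e).isSeparable.span (R := ℝ)).closure

theorem hasSum_inner_sq (e : HilbertBasis ℕ ℝ H) (x : H) :
    HasSum (fun k => inner ℝ (e k) x ^ 2) (‖x‖ ^ 2) := by
  have h := e.hasSum_inner_mul_inner x x
  rw [real_inner_self_eq_norm_sq] at h
  simpa [real_inner_comm, sq] using h

theorem abs_inner_basis_le (e : HilbertBasis ℕ ℝ H) (k : ℕ) (x : H) :
    |inner ℝ (e k) x| ≤ ‖x‖ := by
  simpa [e.orthonormal.1 k] using abs_real_inner_le_norm (e k) x

theorem ext_inner_basis (e : HilbertBasis ℕ ℝ H) {x y : H}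
    (h : ∀ k, inner ℝ (e k) x = inner ℝ (e k) y) : x = y := by
  rw [← sub_eq_zero, ← norm_eq_zero, ← sq_eq_zero_iff]
  refine (hasSum_inner_sq e (x - y)).unique ?_
  simp [inner_sub_right, h, hasSum_zero]

theorem inner_tsum_smul_basis (e : HilbertBasis ℕ ℝ H) {c : ℕ → ℝ}
    (hc : Summable fun k => c k • e k) (k : ℕ) :
    inner ℝ (e k) (∑' j, c j • e j) = c k := by
  have h := hc.hasSum.mapL (innerSL ℝ (e k))
  refine h.unique ?_
  have : (fun j => innerSL ℝ (e k) (c j • e j)) = fun j => if j = k then c k else 0 := by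
    funext j
    have := orthonormal_iff_ite.1 e.orthonormal k j
    by_cases hjk : j = k
    · subst hjk; simp [e.orthonormal.1]
    · simp [this, Ne.symm hjk, hjk]
  rw [this]
  exact hasSum_ite_eq k (c k)

theorem summable_mul_inner_sq (e : HilbertBasis ℕ ℝ H) {q : ℕ → ℝ} (hq : ∀ k, 0 ≤ q k)
    (hs : Summable q) (h : H) : Summable fun k => q k * inner ℝ (e k) h ^ 2 := by
  refine Summable.of_nonneg_of_le (fun k => mul_nonneg (hq k) (sq_nonneg _)) (fun k => ?_)
    (hs.mul_right (‖h‖ ^ 2))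
  exact mul_le_mul_of_nonneg_left (sq_le_sq.2 (by simpa using abs_inner_basis_le e k h)) (hq k)

theorem tsum_mul_inner_basis_sq (e : HilbertBasis ℕ ℝ H) (q : ℕ → ℝ) (k : ℕ) :
    ∑' j, q j * inner ℝ (e j) (e k) ^ 2 = q k := by
  rw [tsum_eq_single k]
  · simp [e.orthonormal.1]
  · intro j hj
    simp [e.orthonormal.2 hj]

/-- A map into a separable Hilbert space is measurable once its coordinates are. -/
theorem measurable_of_inner_basis [CompleteSpace H] [MeasurableSpace H] [BorelSpace H]
    (e : HilbertBasis ℕ ℝ H) {Ω : Type*} [MeasurableSpace Ω] {g : Ω → H}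
    (hg : ∀ k, Measurable fun w => inner ℝ (e k) (g w)) : Measurable g := by
  have h := (measurable_tsum_smul_basis e).comp (measurable_pi_lambda _ hg)
  convert h using 1
  funext w
  have := e.hasSum_repr (g w)
  simp only [e.repr_apply_apply] at this
  exact this.tsum_eq.symm

section Diag

variable [CompleteSpace H] (e : HilbertBasis ℕ ℝ H) {m : ℕ → ℝ} {C : ℝ}

theorem summable_diagOp (hm : ∀ k, |m k| ≤ C) (x : H) :
    Summable fun k => (m k * inner ℝ (e k) x) • e k := by
  rw [summable_smul_basis_iff]
  refine Summable.of_nonneg_of_le (fun k => sq_nonneg _) (fun k => ?_)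
    ((hasSum_inner_sq e x).summable.mul_left (C ^ 2))
  rw [mul_pow]
  exact mul_le_mul_of_nonneg_right (sq_le_sq' (by linarith [abs_le.1 (hm k)]) (abs_le.1 (hm k)).2)
    (sq_nonneg _)

theorem inner_diagOp (hm : ∀ k, |m k| ≤ C) (x : H) (k : ℕ) :
    inner ℝ (e k) (diagOp e m x) = m k * inner ℝ (e k) x :=
  inner_tsum_smul_basis e (summable_diagOp e hm x) k

theorem norm_diagOp_le (hm : ∀ k, |m k| ≤ C) (x : H) : ‖diagOp e m x‖ ≤ C * ‖x‖ := by
  have hC : 0 ≤ C := (abs_nonneg _).trans (hm 0)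
  refine abs_le_of_sq_le_sq' ?_ (by positivity) |>.2
  rw [mul_pow]
  refine hasSum_le (fun k => ?_) (hasSum_inner_sq e _) ((hasSum_inner_sq e x).mul_left (C ^ 2))
  rw [inner_diagOp e hm, mul_pow]
  exact mul_le_mul_of_nonneg_right (sq_le_sq' (by linarith [abs_le.1 (hm k)]) (abs_le.1 (hm k)).2)
    (sq_nonneg _)

/-- The diagonal operator with bounded coefficients `m`, as a continuous linear map. -/
noncomputable def diagL (hm : ∀ k, |m k| ≤ C) : H →L[ℝ] H :=
  LinearMap.mkContinuous
    { toFun := diagOp e m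
      map_add' := fun x y => ext_inner_basis e fun k => by
        simp only [inner_add_right, inner_diagOp e hm]; ring
      map_smul' := fun c x => ext_inner_basis e fun k => by
        simp only [inner_smul_right, inner_diagOp e hm, RingHom.id_apply]; ring }
    C (norm_diagOp_le e hm)

@[simp]
theorem diagL_apply (hm : ∀ k, |m k| ≤ C) (x : H) : diagL e hm x = diagOp e m x := rfl

theorem inner_diagOp_comm (hm : ∀ k, |m k| ≤ C) (x y : H) :
    inner ℝ (diagOp e m x) y = inner ℝ x (diagOp e m y) := by
  rw [← e.tsum_inner_mul_inner, ← e.tsum_inner_mul_inner]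
  refine tsum_congr fun k => ?_
  rw [real_inner_comm, inner_diagOp e hm, inner_diagOp e hm, real_inner_comm x]
  ring

end Diag

end Basis

/-! ### Centred Gaussian measures with diagonal covariance -/

section GaussianMeasure

variable {H : Type*} [NormedAddCommGroup H] [InnerProductSpace ℝ H] [CompleteSpace H]
  [MeasurableSpace H] [BorelSpace H] (e : HilbertBasis ℕ ℝ H)

/-- The law of a sequence of independent standard normal variables. -/
noncomputable def stdGaussian : Measure (ℕ → ℝ) := Measure.infinitePi fun _ => gaussianReal 0 1

instance : IsProbabilityMeasure stdGaussian := by unfold stdGaussian; infer_instance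

/-- All the measures `gaussianMeasure e q` are images of one measure, by maps which are jointly
measurable in the point and the eigenvalues. For negative `q k` both sides are degenerate in the
`k`-th coordinate. -/
theorem gaussianMeasure_eq_map (q : ℕ → ℝ) :
    gaussianMeasure e q = stdGaussian.map fun y => ∑' k, (√(q k) * y k) • e k := by
  have h : (Measure.infinitePi fun k => gaussianReal 0 (q k).toNNReal)
      = stdGaussian.map fun y k => √(q k) * y k := by
    have h1 := Measure.infinitePi_map_pi (μ := fun _ : ℕ => gaussianReal 0 1)
      (f := fun k x => √(q k) * x) (fun k => by fun_prop)
    refine Eq.trans ?_ h1.symm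
    congr 1
    funext k
    rw [gaussianReal_map_const_mul]
    congr 1
    · simp
    · ext; simp [Real.sq_sqrt', Real.coe_toNNReal']
  rw [gaussianMeasure, h, Measure.map_map (measurable_tsum_smul_basis e) (by fun_prop)]
  rfl

instance (q : ℕ → ℝ) : IsProbabilityMeasure (gaussianMeasure e q) :=
  Measure.isProbabilityMeasure_map (measurable_tsum_smul_basis e).aemeasurable

theorem gaussianMeasure_zero : gaussianMeasure e 0 = Measure.dirac 0 := by
  rw [gaussianMeasure_eq_map e]
  simp [Measure.map_const]

/-- If `X`, `Y` are independent, centred Gaussian with diagonal covariances `q`, `q'` and `T` is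
diagonal, then `T X + Y` is centred Gaussian with diagonal covariance. -/
theorem map_prod_gaussianMeasure {q q' m : ℕ → ℝ} {C : ℝ} (hq : ∀ k, 0 ≤ q k) (hs : Summable q)
    (hq' : ∀ k, 0 ≤ q' k) (hs' : Summable q') (hm : ∀ k, |m k| ≤ C) :
    ((gaussianMeasure e q).prod (gaussianMeasure e q')).map (fun p => diagOp e m p.1 + p.2)
      = gaussianMeasure e fun k => m k ^ 2 * q k + q' k := by
  have := separableSpace_of_hilbertBasis e
  have : SecondCountableTopology H := UniformSpace.secondCountable_of_separable H
  have hT : Measurable (diagOp e m) := (diagL e hm).continuous.measurable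
  have h0 : ∀ k, 0 ≤ m k ^ 2 * q k := fun k => mul_nonneg (sq_nonneg _) (hq k)
  have hs0 : Summable fun k => m k ^ 2 * q k :=
    Summable.of_nonneg_of_le h0 (fun k => mul_le_mul_of_nonneg_right
      (sq_le_sq' (by linarith [abs_le.1 (hm k)]) (abs_le.1 (hm k)).2) (hq k)) (hs.mul_left (C ^ 2))
  have hmap : ((gaussianMeasure e q).map (diagOp e m)).prod (gaussianMeasure e q')
      = ((gaussianMeasure e q).prod (gaussianMeasure e q')).map (Prod.map (diagOp e m) id) := by
    rw [← Measure.map_prod_map _ _ hT measurable_id, Measure.map_id]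
  have : IsProbabilityMeasure ((gaussianMeasure e q).map (diagOp e m)) :=
    Measure.isProbabilityMeasure_map hT.aemeasurable
  have hcomp : ((gaussianMeasure e q).prod (gaussianMeasure e q')).map
      (fun p => diagOp e m p.1 + p.2) = (((gaussianMeasure e q).map (diagOp e m)).prod
        (gaussianMeasure e q')).map (fun p => p.1 + p.2) := by
    rw [hmap, Measure.map_map (by fun_prop) (hT.prodMap measurable_id)]
    rfl
  rw [hcomp]
  have : IsProbabilityMeasure ((((gaussianMeasure e q).map (diagOp e m)).prod
        (gaussianMeasure e q')).map (fun p => p.1 + p.2)) :=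
    Measure.isProbabilityMeasure_map (by fun_prop)
  refine Measure.ext_of_charFun ?_
  funext h
  rw [charFun_map_add_prod_eq_mul, Pi.mul_apply, charFun_gaussianMeasure e q' hq' hs',
    charFun_gaussianMeasure e _ (fun k => add_nonneg (h0 k) (hq' k)) (hs0.add hs')]
  have h1 : charFun ((gaussianMeasure e q).map (diagOp e m)) h
      = charFun (gaussianMeasure e q) (diagOp e m h) := by
    rw [charFun_apply, charFun_apply, integral_map hT.aemeasurable
      (Continuous.aestronglyMeasurable (by fun_prop))]
    simp_rw [inner_diagOp_comm e hm]
  rw [h1, charFun_gaussianMeasure e q hq hs, ← Complex.exp_add]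
  congr 1
  rw [← add_div, ← neg_add, ← Complex.ofReal_add]
  congr 3
  rw [← Summable.tsum_add (summable_mul_inner_sq e hq hs _) (summable_mul_inner_sq e hq' hs' _)]
  refine tsum_congr fun k => ?_
  rw [inner_diagOp e hm]
  ring

/-- The image of a centred Gaussian measure under `⟪h, ·⟫`. -/
theorem map_inner_gaussianMeasure {q : ℕ → ℝ} (hq : ∀ k, 0 ≤ q k) (hs : Summable q) (h : H) :
    (gaussianMeasure e q).map (fun y => inner ℝ h y)
      = gaussianReal 0 (∑' k, q k * inner ℝ (e k) h ^ 2).toNNReal := by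
  have hm : Measurable fun y : H => inner ℝ h y := Continuous.measurable (by fun_prop)
  have : IsProbabilityMeasure ((gaussianMeasure e q).map (fun y => inner ℝ h y)) :=
    Measure.isProbabilityMeasure_map hm.aemeasurable
  refine Measure.ext_of_charFun ?_
  funext t
  have h1 : charFun ((gaussianMeasure e q).map (fun y => inner ℝ h y)) t
      = charFun (gaussianMeasure e q) (t • h) := by
    rw [charFun_apply, charFun_apply, integral_map hm.aemeasurable
      (Continuous.aestronglyMeasurable (by fun_prop))]
    simp [inner_smul_right, real_inner_comm, mul_comm]
  have h2 : 0 ≤ ∑' k, q k * inner ℝ (e k) h ^ 2 :=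
    tsum_nonneg fun k => mul_nonneg (hq k) (sq_nonneg _)
  rw [h1, charFun_gaussianMeasure e q hq hs, charFun_gaussianReal]
  congr 1
  have h3 : (((∑' k, q k * inner ℝ (e k) h ^ 2).toNNReal : ℝ) : ℂ)
      = ((∑' k, q k * inner ℝ (e k) h ^ 2 : ℝ) : ℂ) := by rw [Real.coe_toNNReal _ h2]
  rw [h3]
  have h4 : (∑' k, q k * inner ℝ (e k) (t • h) ^ 2) = t ^ 2 * ∑' k, q k * inner ℝ (e k) h ^ 2 := by
    rw [← tsum_mul_left]
    refine tsum_congr fun k => ?_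
    rw [inner_smul_right]; ring
  rw [h4]
  push_cast
  ring

theorem memLp_inner_gaussianMeasure {q : ℕ → ℝ} (hq : ∀ k, 0 ≤ q k) (hs : Summable q) (h : H) :
    MemLp (fun y => inner ℝ h y) 2 (gaussianMeasure e q) := by
  have h1 : MemLp id 2 ((gaussianMeasure e q).map (fun y => inner ℝ h y)) := by
    rw [map_inner_gaussianMeasure e hq hs]
    exact memLp_id_gaussianReal 2
  exact (memLp_map_measure_iff (g := id) (f := fun y => inner ℝ h y) (by fun_prop)
    (Continuous.aemeasurable (by fun_prop))).1 h1

theorem integral_inner_sq_gaussianMeasure {q : ℕ → ℝ} (hq : ∀ k, 0 ≤ q k) (hs : Summable q)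
    (h : H) : ∫ y, inner ℝ h y ^ 2 ∂(gaussianMeasure e q) = ∑' k, q k * inner ℝ (e k) h ^ 2 := by
  have h0 : 0 ≤ ∑' k, q k * inner ℝ (e k) h ^ 2 :=
    tsum_nonneg fun k => mul_nonneg (hq k) (sq_nonneg _)
  have h1 : ∫ y, inner ℝ h y ^ 2 ∂(gaussianMeasure e q)
      = ∫ x, x ^ 2 ∂((gaussianMeasure e q).map (fun y => inner ℝ h y)) :=
    (integral_map (φ := fun y => inner ℝ h y) (f := fun x : ℝ => x ^ 2)
      (Continuous.aemeasurable (by fun_prop)) (by fun_prop)).symm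
  have h2 := variance_fun_id_gaussianReal (μ := 0) (v := (∑' k, q k * inner ℝ (e k) h ^ 2).toNNReal)
  rw [variance_eq_integral (by fun_prop)] at h2
  simp only [integral_id_gaussianReal, sub_zero] at h2
  rw [h1, map_inner_gaussianMeasure e hq hs, h2, Real.coe_toNNReal _ h0]

/-- The coordinates of a centred Gaussian measure with diagonal covariance are uncorrelated. -/
theorem integral_inner_mul_inner_gaussianMeasure {q : ℕ → ℝ} (hq : ∀ k, 0 ≤ q k) (hs : Summable q)
    (j k : ℕ) : ∫ y, inner ℝ (e j) y * inner ℝ (e k) y ∂(gaussianMeasure e q)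
      = if j = k then q k else 0 := by
  split_ifs with hjk
  · subst hjk
    have := integral_inner_sq_gaussianMeasure e hq hs (e j)
    rw [tsum_mul_inner_basis_sq e q] at this
    simpa [sq] using this
  · have hp := integral_inner_sq_gaussianMeasure e hq hs (e j + e k)
    have hn := integral_inner_sq_gaussianMeasure e hq hs (e j - e k)
    have hI : ∀ h : H, Integrable (fun y => inner ℝ h y ^ 2) (gaussianMeasure e q) := fun h =>
      (memLp_inner_gaussianMeasure e hq hs h).integrable_sq
    have hterm : ∀ i, q i * inner ℝ (e i) (e j + e k) ^ 2
        = q i * inner ℝ (e i) (e j - e k) ^ 2 := by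
      intro i
      rw [inner_add_right, inner_sub_right]
      by_cases hij : i = j
      · have : inner ℝ (e i) (e k) = 0 := e.orthonormal.2 (hij ▸ hjk)
        rw [this]; ring
      · have : inner ℝ (e i) (e j) = 0 := e.orthonormal.2 hij
        rw [this]; ring
    have hpt : ∀ y : H, inner ℝ (e j) y * inner ℝ (e k) y
        = (1 / 4 : ℝ) * (inner ℝ (e j + e k) y ^ 2 - inner ℝ (e j - e k) y ^ 2) := by
      intro y
      rw [inner_add_left, inner_sub_left]; ring
    simp_rw [hpt]
    rw [integral_const_mul, integral_sub (hI _) (hI _), hp, hn, tsum_congr hterm]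
    ring

end GaussianMeasure

/-! ### Gaussian Hilbert spaces -/

section OneDim

open scoped NNReal

/-- The integrand is the remainder of the first order expansion, in the direction of `x`, of the
density of a shifted Gaussian law. -/
theorem integral_exp_remainder_sq (v : ℝ≥0) :
    ∫ x, (Real.exp (x - v / 2) - 1 - x) ^ 2 ∂(gaussianReal 0 v) = Real.exp v - 1 - v := by
  have hint : ∀ t : ℝ, Integrable (fun x => Real.exp (t * x)) (gaussianReal 0 v) :=
    integrable_exp_mul_gaussianReal
  have hexp : ∀ t : ℝ, ∫ x, Real.exp (t * x) ∂(gaussianReal 0 v) = Real.exp (v * t ^ 2 / 2) := by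
    intro t
    have := congrFun (mgf_fun_id_gaussianReal (μ := 0) (v := v)) t
    simpa [mgf] using this
  have hmem : ∀ t : ℝ, t ∈ interior (integrableExpSet (fun x => x) (gaussianReal 0 v)) := by
    intro t; simp [integrableExpSet_fun_id_gaussianReal]
  have hxint : Integrable (fun x => x * Real.exp (1 * x)) (gaussianReal 0 v) := by
    simpa using integrable_pow_mul_exp_of_mem_interior_integrableExpSet (hmem 1) 1
  have hx : ∫ x, x * Real.exp (1 * x) ∂(gaussianReal 0 v) = v * Real.exp (v / 2) := by
    rw [← deriv_mgf (hmem 1), mgf_fun_id_gaussianReal]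
    have : HasDerivAt (fun t : ℝ => Real.exp (0 * t + v * t ^ 2 / 2))
        (Real.exp (0 * 1 + v * 1 ^ 2 / 2) * (v : ℝ)) 1 := by
      refine HasDerivAt.exp ?_
      have h := ((hasDerivAt_pow 2 (1 : ℝ)).const_mul (v : ℝ)).div_const 2
      simpa using h
    rw [this.deriv]
    simp [mul_comm]
  have hid : ∫ x, x ∂(gaussianReal 0 v) = 0 := integral_id_gaussianReal
  have hidint : Integrable (fun x : ℝ => x) (gaussianReal 0 v) :=
    (memLp_id_gaussianReal 1).integrable (by norm_num)
  have hsqint : Integrable (fun x : ℝ => x ^ 2) (gaussianReal 0 v) :=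
    (memLp_id_gaussianReal 2).integrable_sq
  have hsq : ∫ x, x ^ 2 ∂(gaussianReal 0 v) = v := by
    have h2 := variance_fun_id_gaussianReal (μ := 0) (v := v)
    rw [variance_eq_integral (by fun_prop)] at h2
    simpa using h2
  have hpt : ∀ x : ℝ, (Real.exp (x - v / 2) - 1 - x) ^ 2
      = Real.exp (-v) * Real.exp (2 * x) + (-2 * Real.exp (-v / 2)) * Real.exp (1 * x)
        + (-2 * Real.exp (-v / 2)) * (x * Real.exp (1 * x)) + (1 + (2 * x + x ^ 2)) := by
    intro x
    have h1 : Real.exp (x - v / 2) = Real.exp (-v / 2) * Real.exp x := by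
      rw [← Real.exp_add]; congr 1; ring
    have h2 : Real.exp (-v) = Real.exp (-v / 2) ^ 2 := by
      rw [← Real.exp_nat_mul]; congr 1; push_cast; ring
    have h3 : Real.exp (2 * x) = Real.exp x ^ 2 := by
      rw [← Real.exp_nat_mul]; congr 1
    rw [h1, h2, h3, one_mul]
    ring
  simp_rw [hpt]
  have i1 := (hint 2).const_mul (Real.exp (-v))
  have i2 := (hint 1).const_mul (-2 * Real.exp (-v / 2))
  have i3 := hxint.const_mul (-2 * Real.exp (-v / 2))
  have i4 : Integrable (fun x : ℝ => 1 + (2 * x + x ^ 2)) (gaussianReal 0 v) :=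
    (integrable_const _).add ((hidint.const_mul 2).add hsqint)
  have j2 := integral_add i1 i2
  have j3 := integral_add (i1.add i2) i3
  have j4 := integral_add ((i1.add i2).add i3) i4
  have j1 := integral_add (hidint.const_mul 2) hsqint
  have j0 := integral_add (integrable_const (1 : ℝ)) ((hidint.const_mul 2).add hsqint)
  simp only [Pi.add_apply] at j0 j1 j2 j3 j4
  rw [j4, j3, j2, j0, j1, integral_const_mul, integral_const_mul,
    integral_const_mul, integral_const_mul, hexp, hexp, hx, hid, hsq]
  have e1 : Real.exp (-v) * Real.exp (v * 2 ^ 2 / 2) = Real.exp v := by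
    rw [← Real.exp_add]; congr 1; ring
  have e2 : Real.exp (-(v : ℝ) / 2) * Real.exp (v / 2) = 1 := by
    rw [← Real.exp_add, neg_div, neg_add_cancel, Real.exp_zero]
  have e3 : Real.exp ((v : ℝ) * 1 ^ 2 / 2) = Real.exp (v / 2) := by simp
  rw [e1, e3, mul_assoc, mul_assoc, mul_left_comm _ (v : ℝ), e2]
  simp
  ring

end OneDim

section WhiteNoise

variable {H : Type*} [NormedAddCommGroup H] [InnerProductSpace ℝ H]
  {Ω : Type*} [MeasurableSpace Ω] {μ : Measure Ω}

/-- A linear isometry `W` of `H` into `L²(μ)` is a white noise (an isonormal Gaussian process) if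
each `W g` is centred Gaussian with variance `‖g‖²`, expressed through the characteristic
function. -/
def IsWhiteNoise (W : H →ₗᵢ[ℝ] Lp ℝ 2 μ) : Prop :=
  ∀ g, ∫ w, Complex.exp (W g w * Complex.I) ∂μ = Complex.exp (-((‖g‖ ^ 2 : ℝ) : ℂ) / 2)

namespace IsWhiteNoise

variable {W : H →ₗᵢ[ℝ] Lp ℝ 2 μ}

theorem aemeasurable (W : H →ₗᵢ[ℝ] Lp ℝ 2 μ) (g : H) : AEMeasurable (W g) μ :=
  (Lp.aestronglyMeasurable _).aemeasurable

theorem coeFn_smul_add (W : H →ₗᵢ[ℝ] Lp ℝ 2 μ) (a b : ℝ) (g h : H) :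
    W (a • g + b • h) =ᵐ[μ] fun w => a * W g w + b * W h w := by
  rw [map_add, map_smul, map_smul]
  filter_upwards [Lp.coeFn_add (a • W g) (b • W h), Lp.coeFn_smul a (W g),
    Lp.coeFn_smul b (W h)] with w h1 h2 h3
  rw [h1, Pi.add_apply, h2, h3]
  rfl

theorem coeFn_smul (W : H →ₗᵢ[ℝ] Lp ℝ 2 μ) (a : ℝ) (g : H) :
    W (a • g) =ᵐ[μ] fun w => a * W g w := by
  simpa using coeFn_smul_add W a 0 g g

variable (hW : IsWhiteNoise W)
include hW

theorem charFun_map (g : H) (t : ℝ) :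
    charFun (μ.map (W g)) t = Complex.exp (-((t ^ 2 * ‖g‖ ^ 2 : ℝ) : ℂ) / 2) := by
  have h := hW (t • g)
  rw [norm_smul, mul_pow, Real.norm_eq_abs, sq_abs] at h
  rw [← h, charFun_apply_real, integral_map (aemeasurable W g) (by fun_prop)]
  refine integral_congr_ae ?_
  filter_upwards [coeFn_smul W t g] with w hw
  rw [hw]; push_cast; rfl

variable [IsProbabilityMeasure μ]

theorem map_eq (g : H) : μ.map (W g) = gaussianReal 0 (‖g‖₊ ^ 2) := by
  have : IsProbabilityMeasure (μ.map (W g)) := Measure.isProbabilityMeasure_map (aemeasurable W g)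
  refine Measure.ext_of_charFun ?_
  funext t
  rw [hW.charFun_map, charFun_gaussianReal]
  congr 1
  push_cast
  ring

theorem indepFun {g h : H} (hgh : inner ℝ g h = 0) : IndepFun (W g) (W h) μ := by
  rw [indepFun_iff_charFun_prod (aemeasurable W g) (aemeasurable W h)]
  intro t
  rw [hW.charFun_map, hW.charFun_map, charFun_apply, integral_map
    (by have := aemeasurable W g; have := aemeasurable W h; fun_prop)
    (Continuous.aestronglyMeasurable (by fun_prop)), ← Complex.exp_add]
  have h1 := hW (t.fst • g + t.snd • h)
  have h2 : ‖t.fst • g + t.snd • h‖ ^ 2 = t.fst ^ 2 * ‖g‖ ^ 2 + t.snd ^ 2 * ‖h‖ ^ 2 := by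
    rw [norm_add_sq_real, inner_smul_left, inner_smul_right, hgh, norm_smul, norm_smul, mul_pow,
      mul_pow]
    simp
  rw [h2] at h1
  refine Eq.trans ?_ (h1.trans ?_)
  · refine integral_congr_ae ?_
    filter_upwards [coeFn_smul_add W t.fst t.snd g h] with w hw
    rw [hw]
    simp [WithLp.prod_inner_apply, mul_comm]
  · congr 1
    simp only [WithLp.fst, WithLp.snd]
    push_cast
    ring

theorem integrable_exp (g : H) : Integrable (fun w => Real.exp (W g w)) μ := by
  have h := integrable_exp_mul_gaussianReal (μ := 0) (v := ‖g‖₊ ^ 2) 1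
  rw [← hW.map_eq g, integrable_map_measure (by fun_prop) (aemeasurable W g)] at h
  simpa [Function.comp_def] using h

theorem integral_cexp_mul (g : H) (z : ℂ) :
    ∫ w, Complex.exp (z * W g w) ∂μ = Complex.exp (‖g‖ ^ 2 * z ^ 2 / 2) := by
  have h := complexMGF_gaussianReal (hW.map_eq g) z
  rw [complexMGF] at h
  rw [h]
  simp

/-- The joint exponential moments of `W h` and `W g` at the points `i` and `1`; the component of
`h` orthogonal to `g` contributes an independent factor. -/
theorem integral_cexp (h g : H) :
    ∫ w, Complex.exp (W h w * Complex.I) * Complex.exp (W g w) ∂μ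
      = Complex.exp (((‖g‖ ^ 2 - ‖h‖ ^ 2 : ℝ) : ℂ) / 2 + (inner ℝ h g : ℝ) * Complex.I) := by
  obtain ⟨c, h', hh, horth⟩ : ∃ (c : ℝ) (h' : H), h = c • g + h' ∧ inner ℝ h' g = 0 := by
    by_cases hg : g = 0
    · exact ⟨0, h, by simp, by simp [hg]⟩
    · refine ⟨inner ℝ h g / ‖g‖ ^ 2, h - (inner ℝ h g / ‖g‖ ^ 2) • g, by simp, ?_⟩
      have : ‖g‖ ≠ 0 := norm_ne_zero_iff.2 hg
      rw [inner_sub_left, inner_smul_left, real_inner_self_eq_norm_sq]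
      simp [this]
  have hind := hW.indepFun horth
  have h1 : ∫ w, Complex.exp (W h w * Complex.I) * Complex.exp (W g w) ∂μ
      = ∫ w, Complex.exp (W h' w * Complex.I) * Complex.exp ((1 + c * Complex.I) * W g w) ∂μ := by
    refine integral_congr_ae ?_
    filter_upwards [coeFn_smul_add W c 1 g h'] with w hw
    rw [one_smul, ← hh] at hw
    rw [hw, ← Complex.exp_add, ← Complex.exp_add]
    congr 1
    push_cast
    ring
  have h2 := hind.integral_fun_comp_mul_comp (aemeasurable W h') (aemeasurable W g)
    (f := fun x : ℝ => Complex.exp (x * Complex.I))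
    (g := fun x : ℝ => Complex.exp ((1 + c * Complex.I) * x)) (by fun_prop) (by fun_prop)
  rw [h1, h2, hW h', hW.integral_cexp_mul, ← Complex.exp_add]
  congr 1
  have h3 : inner ℝ h g = c * ‖g‖ ^ 2 := by
    rw [hh, inner_add_left, inner_smul_left, horth, real_inner_self_eq_norm_sq]; simp
  have h4 : ‖h‖ ^ 2 = c ^ 2 * ‖g‖ ^ 2 + ‖h'‖ ^ 2 := by
    have : inner ℝ g h' = 0 := by rw [real_inner_comm]; exact horth
    rw [hh, norm_add_sq_real, inner_smul_left, this, norm_smul, mul_pow]; simp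
  rw [h3, h4]
  push_cast
  linear_combination ((‖g‖ : ℂ) ^ 2 * c ^ 2 / 2) * Complex.I_sq

/-- The Cameron-Martin density `exp (W g - ‖g‖²/2)` differs from its linearisation at `g = 0` by
a term of second order in `L¹`. -/
theorem integral_abs_remainder_le {g : H} (hg : ‖g‖ ≤ 1) :
    ∫ w, |Real.exp (W g w - ‖g‖ ^ 2 / 2) - 1 - W g w| ∂μ ≤ ‖g‖ ^ 2 := by
  have hm := aemeasurable W g
  set r : ℝ → ℝ := fun x => Real.exp (x - ‖g‖ ^ 2 / 2) - 1 - x with hr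
  have hrm : Measurable r := by fun_prop
  have hsq : ∫ w, r (W g w) ^ 2 ∂μ = Real.exp (‖g‖ ^ 2) - 1 - ‖g‖ ^ 2 := by
    have h := integral_exp_remainder_sq (‖g‖₊ ^ 2)
    rw [← hW.map_eq g, integral_map hm (by fun_prop)] at h
    simpa using h
  have hW2 : MemLp (W g) 2 μ := Lp.memLp _
  have hexp2 : MemLp (fun w => Real.exp (W g w - ‖g‖ ^ 2 / 2)) 2 μ := by
    rw [memLp_two_iff_integrable_sq (by fun_prop)]
    refine ((hW.integrable_exp ((2 : ℝ) • g)).mul_const (Real.exp (-‖g‖ ^ 2))).congr ?_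
    filter_upwards [coeFn_smul W 2 g] with w hw
    rw [hw, ← Real.exp_add, ← Real.exp_nat_mul]
    congr 1
    push_cast
    ring
  have hmem : MemLp (fun w => r (W g w)) 2 μ := (hexp2.sub (memLp_const 1)).sub hW2
  -- Jensen's inequality, as nonnegativity of a variance
  have hjen : (∫ w, |r (W g w)| ∂μ) ^ 2 ≤ ∫ w, |r (W g w)| ^ 2 ∂μ := by
    have h0 := variance_nonneg (fun w => |r (W g w)|) μ
    have h1 : MemLp (fun w => |r (W g w)|) 2 μ := hmem.abs
    rw [variance_eq_sub h1] at h0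
    simpa using h0
  simp_rw [sq_abs] at hjen
  rw [hsq] at hjen
  have hb : Real.exp (‖g‖ ^ 2) - 1 - ‖g‖ ^ 2 ≤ (‖g‖ ^ 2) ^ 2 := by
    have h1 : |‖g‖ ^ 2| ≤ 1 := by
      rw [abs_of_nonneg (by positivity)]
      exact pow_le_one₀ (norm_nonneg _) hg
    exact (le_abs_self _).trans (Real.abs_exp_sub_one_sub_id_le h1)
  exact abs_le_of_sq_le_sq' (hjen.trans hb) (by positivity) |>.2

end IsWhiteNoise

end WhiteNoise

/-! ### The Cameron-Martin formula -/

section SqrtCovariance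

variable {H : Type*} [NormedAddCommGroup H] [InnerProductSpace ℝ H]

theorem abs_sqrt_le_sqrt_tsum {q : ℕ → ℝ} (hq : ∀ k, 0 ≤ q k) (hs : Summable q) (k : ℕ) :
    |√(q k)| ≤ √(∑' j, q j) := by
  rw [abs_of_nonneg (Real.sqrt_nonneg _)]
  exact Real.sqrt_le_sqrt (hs.le_tsum k fun j _ => hq j)

theorem norm_diagOp_sqrt_sq [CompleteSpace H] (e : HilbertBasis ℕ ℝ H) {q : ℕ → ℝ}
    (hq : ∀ k, 0 ≤ q k) (hs : Summable q) (h : H) :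
    ‖diagOp e (fun k => √(q k)) h‖ ^ 2 = ∑' k, q k * inner ℝ (e k) h ^ 2 := by
  rw [← (hasSum_inner_sq e _).tsum_eq]
  refine tsum_congr fun k => ?_
  rw [inner_diagOp e (abs_sqrt_le_sqrt_tsum hq hs), mul_pow, Real.sq_sqrt (hq k)]

end SqrtCovariance

section CameronMartin

variable {H : Type*} [NormedAddCommGroup H] [InnerProductSpace ℝ H] [CompleteSpace H]
  [MeasurableSpace H] [BorelSpace H] (e : HilbertBasis ℕ ℝ H) {q : ℕ → ℝ}

/-- The functional `⟪h, ·⟫` as an element of `L²` of a Gaussian measure. -/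
noncomputable def innerL2 (hq : ∀ k, 0 ≤ q k) (hs : Summable q) :
    H →L[ℝ] Lp ℝ 2 (gaussianMeasure e q) :=
  LinearMap.mkContinuous
    { toFun := fun h => (memLp_inner_gaussianMeasure e hq hs h).toLp
      map_add' := fun x y => by
        rw [← MemLp.toLp_add]
        exact MemLp.toLp_congr _ _ (Eventually.of_forall fun w => inner_add_left x y w)
      map_smul' := fun c x => by
        rw [RingHom.id_apply, ← MemLp.toLp_const_smul]
        exact MemLp.toLp_congr _ _ (Eventually.of_forall fun w => real_inner_smul_left x w c) }
    (√(∑' j, q j)) (fun h => by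
      refine le_trans (le_of_eq ?_) (norm_diagOp_le e (abs_sqrt_le_sqrt_tsum hq hs) h)
      rw [← sq_eq_sq₀ (norm_nonneg _) (norm_nonneg _), norm_diagOp_sqrt_sq e hq hs,
        ← integral_inner_sq_gaussianMeasure e hq hs, ← real_inner_self_eq_norm_sq, L2.inner_def]
      refine integral_congr_ae ?_
      filter_upwards [(memLp_inner_gaussianMeasure e hq hs h).coeFn_toLp] with w hw
      simp only [LinearMap.coe_mk, AddHom.coe_mk]
      rw [hw, real_inner_self_eq_norm_sq, Real.norm_eq_abs, sq_abs])

theorem innerL2_ae (hq : ∀ k, 0 ≤ q k) (hs : Summable q) (h : H) :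
    innerL2 e hq hs h =ᵐ[gaussianMeasure e q] fun y => inner ℝ h y :=
  (memLp_inner_gaussianMeasure e hq hs h).coeFn_toLp

/-- A nondegenerate Gaussian measure carries a white noise `W`, which extends
`Q^{1/2} h ↦ ⟪h, ·⟫` to all of `H`. -/
theorem exists_isWhiteNoise (hq : ∀ k, 0 < q k) (hs : Summable q) :
    ∃ W : H →ₗᵢ[ℝ] Lp ℝ 2 (gaussianMeasure e q), IsWhiteNoise W ∧
      ∀ h, W (diagOp e (fun k => √(q k)) h) =ᵐ[gaussianMeasure e q] fun y => inner ℝ h y := by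
  have hq0 : ∀ k, 0 ≤ q k := fun k => (hq k).le
  have hb := abs_sqrt_le_sqrt_tsum hq0 hs
  set J := innerL2 e hq0 hs with hJ
  set v : ℕ → Lp ℝ 2 (gaussianMeasure e q) := fun k => (√(q k))⁻¹ • J (e k) with hv
  have hsq : ∀ k, √(q k) ≠ 0 := fun k => (Real.sqrt_pos.2 (hq k)).ne'
  have hinner : ∀ j k, inner ℝ (J (e j)) (J (e k)) = if j = k then q k else 0 := by
    intro j k
    rw [L2.inner_def, ← integral_inner_mul_inner_gaussianMeasure e hq0 hs j k]
    refine integral_congr_ae ?_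
    filter_upwards [innerL2_ae e hq0 hs (e j), innerL2_ae e hq0 hs (e k)] with w h1 h2
    rw [hJ, h1, h2]
    exact mul_comm _ _
  -- the normalised coordinates `⟪e_k, ·⟫ / √q_k` are orthonormal, and `W` sends `e_k` to them
  have hon : Orthonormal ℝ v := by
    rw [orthonormal_iff_ite]
    intro j k
    simp only [hv, real_inner_smul_left, real_inner_smul_right, hinner]
    split_ifs with h
    · subst h
      rw [← mul_assoc, ← mul_inv, Real.mul_self_sqrt (hq0 j), inv_mul_cancel₀ (hq j).ne']
    · simp
  have hof := hon.orthogonalFamily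
  set W : H →ₗᵢ[ℝ] Lp ℝ 2 (gaussianMeasure e q) :=
    hof.linearIsometry.comp e.repr.toLinearIsometry with hW
  have hWe : ∀ k, W (e k) = v k := by
    intro k
    classical
    change hof.linearIsometry (e.repr (e k)) = v k
    rw [e.repr_self, hof.linearIsometry_apply_single]
    simp
  have hWQ : W.toContinuousLinearMap.comp (diagL e hb) = J := by
    refine ContinuousLinearMap.ext_on (s := range e) ?_ ?_
    · rw [dense_iff_closure_eq, ← Submodule.topologicalClosure_coe, e.dense_span]; rfl
    · rintro _ ⟨k, rfl⟩
      have h1 : diagOp e (fun k => √(q k)) (e k) = √(q k) • e k := by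
        refine ext_inner_basis e fun j => ?_
        rw [inner_diagOp e hb, real_inner_smul_right]
        by_cases hjk : j = k
        · rw [hjk]
        · rw [e.orthonormal.2 hjk]; simp
      simp [h1, hWe, hv, smul_smul, hsq k]
  have hWQ' : ∀ h, W (diagOp e (fun k => √(q k)) h) = J h := fun h =>
    congrArg (fun L => L h) hWQ
  refine ⟨W, ?_, fun h => by rw [hWQ']; exact innerL2_ae e hq0 hs h⟩
  -- on the dense range of `Q^{1/2}` the characteristic function of `W` is that of the Gaussian
  -- measure, and both sides of the identity to be shown are continuous
  have hdense : DenseRange (diagL e hb) := by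
    have h1 : (LinearMap.range (diagL e hb).toLinearMap).topologicalClosure = ⊤ := by
      rw [eq_top_iff, ← e.dense_span]
      refine Submodule.topologicalClosure_mono (Submodule.span_le.2 ?_)
      rintro _ ⟨k, rfl⟩
      refine ⟨(√(q k))⁻¹ • e k, ext_inner_basis e fun j => ?_⟩
      change inner ℝ (e j) (diagOp e (fun k => √(q k)) _) = _
      rw [inner_diagOp e hb, real_inner_smul_right]
      by_cases hjk : j = k
      · rw [hjk, ← mul_assoc, mul_inv_cancel₀ (hsq k), one_mul]
      · rw [e.orthonormal.2 hjk]; simp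
    have h2 := (Submodule.dense_iff_topologicalClosure_eq_top.2 h1)
    exact h2
  have hcont : Continuous fun g => ∫ w, Complex.exp (W g w * Complex.I) ∂(gaussianMeasure e q) := by
    have hint : ∀ g, Integrable (fun w => Complex.exp (W g w * Complex.I))
        (gaussianMeasure e q) := by
      intro g
      refine Integrable.of_bound (C := 1) ?_
        (Eventually.of_forall fun w => (Complex.norm_exp_ofReal_mul_I _).le)
      have := IsWhiteNoise.aemeasurable W g
      exact AEMeasurable.aestronglyMeasurable (by fun_prop)
    have hL : LipschitzWith 1
        fun g => ∫ w, Complex.exp (W g w * Complex.I) ∂(gaussianMeasure e q) := by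
      refine LipschitzWith.of_dist_le_mul fun g h => ?_
      rw [dist_eq_norm, dist_eq_norm, ← integral_sub (hint g) (hint h), NNReal.coe_one, one_mul]
      have hmem : MemLp (W (g - h)) 2 (gaussianMeasure e q) := Lp.memLp _
      calc ‖∫ w, (Complex.exp (W g w * Complex.I) - Complex.exp (W h w * Complex.I))
              ∂(gaussianMeasure e q)‖
          ≤ ∫ w, |W (g - h) w| ∂(gaussianMeasure e q) := by
            refine norm_integral_le_of_norm_le (hmem.abs.integrable (by norm_num)) ?_
            rw [map_sub]
            filter_upwards [Lp.coeFn_sub (W g) (W h)] with w hw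
            rw [hw, Pi.sub_apply]
            have h1 : Complex.exp (W g w * Complex.I) - Complex.exp (W h w * Complex.I)
                = Complex.exp (W h w * Complex.I)
                  * (Complex.exp (Complex.I * (W g w - W h w : ℝ)) - 1) := by
              rw [mul_sub, ← Complex.exp_add, mul_one]
              congr 2
              push_cast
              ring
            rw [h1, norm_mul, Complex.norm_exp_ofReal_mul_I, one_mul]
            exact Real.norm_exp_I_mul_ofReal_sub_one_le
        _ ≤ ‖g - h‖ := by
            have h1 : MemLp (fun w => |W (g - h) w|) 2 (gaussianMeasure e q) := hmem.abs
            have h0 := variance_nonneg (fun w => |W (g - h) w|) (gaussianMeasure e q)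
            rw [variance_eq_sub h1] at h0
            have h2 : ∫ w, W (g - h) w ^ 2 ∂(gaussianMeasure e q) = ‖g - h‖ ^ 2 := by
              rw [← W.norm_map, ← real_inner_self_eq_norm_sq, L2.inner_def]
              refine integral_congr_ae (Eventually.of_forall fun w => ?_)
              simp [sq]
            simp only [Pi.pow_apply, sq_abs] at h0
            rw [h2] at h0
            exact abs_le_of_sq_le_sq' (by linarith) (norm_nonneg _) |>.2
    exact hL.continuous
  have hcont' : Continuous fun g : H => Complex.exp (-((‖g‖ ^ 2 : ℝ) : ℂ) / 2) := by fun_prop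
  refine fun g => congrFun (hdense.equalizer hcont hcont' ?_) g
  funext h
  simp only [Function.comp_apply, diagL_apply]
  rw [norm_diagOp_sqrt_sq e hq0 hs, ← charFun_gaussianMeasure e q hq0 hs, charFun_apply, hWQ']
  refine integral_congr_ae ?_
  filter_upwards [innerL2_ae e hq0 hs h] with w hw
  rw [hJ, hw, real_inner_comm]

/-- **Cameron-Martin formula**: the translate of a Gaussian measure by `Q^{1/2} g` has density
`exp (W g - ‖g‖²/2)`. -/
theorem map_add_gaussianMeasure (hq : ∀ k, 0 ≤ q k) (hs : Summable q)
    {W : H →ₗᵢ[ℝ] Lp ℝ 2 (gaussianMeasure e q)} (hW : IsWhiteNoise W)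
    (hWQ : ∀ h, W (diagOp e (fun k => √(q k)) h) =ᵐ[gaussianMeasure e q] fun y => inner ℝ h y)
    (g : H) :
    (gaussianMeasure e q).map (fun y => y + diagOp e (fun k => √(q k)) g)
      = (gaussianMeasure e q).withDensity
          fun y => ENNReal.ofReal (Real.exp (W g y - ‖g‖ ^ 2 / 2)) := by
  have := separableSpace_of_hilbertBasis e
  have : SecondCountableTopology H := UniformSpace.secondCountable_of_separable H
  have hb := abs_sqrt_le_sqrt_tsum hq hs
  have hexp : ∀ y, Real.exp (W g y - ‖g‖ ^ 2 / 2) = Real.exp (-‖g‖ ^ 2 / 2) * Real.exp (W g y) := by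
    intro y
    rw [← Real.exp_add]; congr 1; ring
  have hint : Integrable (fun y => Real.exp (W g y - ‖g‖ ^ 2 / 2)) (gaussianMeasure e q) := by
    simp_rw [hexp]
    exact (hW.integrable_exp g).const_mul _
  have := isFiniteMeasure_withDensity_ofReal hint.2
  have := Measure.isProbabilityMeasure_map (μ := gaussianMeasure e q)
    (f := fun y => y + diagOp e (fun k => √(q k)) g) (by fun_prop)
  refine Measure.ext_of_charFun ?_
  funext h
  have hm := IsWhiteNoise.aemeasurable W g
  rw [charFun_apply, charFun_apply, integral_map (by fun_prop)
    (Continuous.aestronglyMeasurable (by fun_prop)),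
    integral_withDensity_eq_integral_toReal_smul₀ (by fun_prop)
      (Eventually.of_forall fun y => ENNReal.ofReal_lt_top)]
  have h1 : ∫ y, (ENNReal.ofReal (Real.exp (W g y - ‖g‖ ^ 2 / 2))).toReal •
        Complex.exp (inner ℝ y h * Complex.I) ∂(gaussianMeasure e q)
      = ∫ y, Complex.exp (-(‖g‖ ^ 2 : ℝ) / 2) *
        (Complex.exp (W (diagOp e (fun k => √(q k)) h) y * Complex.I) * Complex.exp (W g y))
          ∂(gaussianMeasure e q) := by
    refine integral_congr_ae ?_
    filter_upwards [hWQ h] with y hy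
    rw [hy, ENNReal.toReal_ofReal (Real.exp_nonneg _), hexp, real_inner_comm, Complex.real_smul]
    push_cast
    ring
  have h2 : ∫ y, Complex.exp (inner ℝ (y + diagOp e (fun k => √(q k)) g) h * Complex.I)
        ∂(gaussianMeasure e q)
      = ∫ y, Complex.exp (inner ℝ g (diagOp e (fun k => √(q k)) h) * Complex.I) *
        Complex.exp (W (diagOp e (fun k => √(q k)) h) y * Complex.I) ∂(gaussianMeasure e q) := by
    refine integral_congr_ae ?_
    filter_upwards [hWQ h] with y hy
    rw [hy, inner_add_left, inner_diagOp_comm e hb, ← Complex.exp_add, real_inner_comm y]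
    congr 1
    push_cast
    ring
  rw [h1, h2, integral_const_mul, integral_const_mul, hW, hW.integral_cexp, ← Complex.exp_add,
    ← Complex.exp_add, real_inner_comm]
  congr 1
  push_cast
  ring

/-- First order expansion of `g ↦ ∫ φ (y + Q^{1/2} g)` for `φ` merely bounded and measurable, with
a quadratic remainder that depends on `φ` only through its bound. The gradient is `W* φ`, where
`W* : L² → H` is the adjoint of the white noise. -/
theorem exists_gradient_integral_shift (hq : ∀ k, 0 < q k) (hs : Summable q) {φ : H → ℝ}
    (hφ : Measurable φ) {M : ℝ} (hM : ∀ y, |φ y| ≤ M) :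
    ∃ m : H, ‖m‖ ≤ M ∧ ∀ g : H, ‖g‖ ≤ 1 →
      |∫ y, φ (y + diagOp e (fun k => √(q k)) g) ∂(gaussianMeasure e q)
        - ∫ y, φ y ∂(gaussianMeasure e q) - inner ℝ m g| ≤ M * ‖g‖ ^ 2 := by
  obtain ⟨W, hW, hWQ⟩ := exists_isWhiteNoise e hq hs
  have hM0 : 0 ≤ M := (abs_nonneg _).trans (hM 0)
  have hmem : MemLp φ 2 (gaussianMeasure e q) :=
    MemLp.of_bound hφ.aestronglyMeasurable M (Eventually.of_forall hM)
  refine ⟨W.toContinuousLinearMap.adjoint hmem.toLp, ?_, fun g hg => ?_⟩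
  · calc ‖W.toContinuousLinearMap.adjoint hmem.toLp‖
        ≤ ‖W.toContinuousLinearMap.adjoint‖ * ‖hmem.toLp‖ := ContinuousLinearMap.le_opNorm _ _
      _ ≤ 1 * M := by
          refine mul_le_mul ?_ ?_ (norm_nonneg _) zero_le_one
          · rw [LinearIsometryEquiv.norm_map]
            exact W.norm_toContinuousLinearMap_le
          · have h1 : ∀ᵐ y ∂(gaussianMeasure e q), ‖hmem.toLp φ y‖ ≤ M := by
              filter_upwards [hmem.coeFn_toLp] with y hy
              rw [hy]; exact hM y
            have := Lp.norm_le_of_ae_bound hM0 h1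
            have h2 : measureUnivNNReal (gaussianMeasure e q) = 1 := by simp [measureUnivNNReal]
            simpa [h2] using this
      _ = M := one_mul M
  · have hm := IsWhiteNoise.aemeasurable W g
    have hexpint : Integrable (fun y => Real.exp (W g y - ‖g‖ ^ 2 / 2)) (gaussianMeasure e q) := by
      have : ∀ y, Real.exp (W g y - ‖g‖ ^ 2 / 2)
          = Real.exp (-‖g‖ ^ 2 / 2) * Real.exp (W g y) := by
        intro y
        rw [← Real.exp_add]; congr 1; ring
      simp_rw [this]
      exact (hW.integrable_exp g).const_mul _
    have hWint : Integrable (W g) (gaussianMeasure e q) := (Lp.memLp (W g)).integrable (by norm_num)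
    have hshift : ∫ y, φ (y + diagOp e (fun k => √(q k)) g) ∂(gaussianMeasure e q)
        = ∫ y, Real.exp (W g y - ‖g‖ ^ 2 / 2) * φ y ∂(gaussianMeasure e q) := by
      have h1 := integral_map (μ := gaussianMeasure e q)
        (φ := fun y => y + diagOp e (fun k => √(q k)) g) (f := φ) (by fun_prop)
        hφ.aestronglyMeasurable
      rw [← h1, map_add_gaussianMeasure e (fun k => (hq k).le) hs hW hWQ,
        integral_withDensity_eq_integral_toReal_smul₀ (by fun_prop)
          (Eventually.of_forall fun y => ENNReal.ofReal_lt_top)]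
      refine integral_congr_ae (Eventually.of_forall fun y => ?_)
      simp only [ENNReal.toReal_ofReal (Real.exp_nonneg _), smul_eq_mul]
    have hin : inner ℝ (W.toContinuousLinearMap.adjoint hmem.toLp) g
        = ∫ y, W g y * φ y ∂(gaussianMeasure e q) := by
      rw [ContinuousLinearMap.adjoint_inner_left, L2.inner_def]
      refine integral_congr_ae ?_
      filter_upwards [hmem.coeFn_toLp] with y hy
      rw [hy]; rfl
    have hb : ∀ {ψ : H → ℝ}, Integrable ψ (gaussianMeasure e q) →
        Integrable (fun y => ψ y * φ y) (gaussianMeasure e q) := fun hψ =>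
      hψ.mul_bdd (c := M) hφ.aestronglyMeasurable (Eventually.of_forall hM)
    have hone : ∫ y, φ y ∂(gaussianMeasure e q) = ∫ y, 1 * φ y ∂(gaussianMeasure e q) := by simp
    have j1 := integral_sub (hb hexpint) (hb (integrable_const 1))
    have j2 := integral_sub ((hb hexpint).sub (hb (integrable_const 1))) (hb hWint)
    simp only [Pi.sub_apply] at j1 j2
    rw [hshift, hin, hone, ← j1, ← j2]
    have hrem : Integrable (fun y => |Real.exp (W g y - ‖g‖ ^ 2 / 2) - 1 - W g y|)
        (gaussianMeasure e q) := ((hexpint.sub (integrable_const 1)).sub hWint).abs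
    calc |∫ y, (Real.exp (W g y - ‖g‖ ^ 2 / 2) * φ y - 1 * φ y - W g y * φ y)
            ∂(gaussianMeasure e q)|
        ≤ ∫ y, M * |Real.exp (W g y - ‖g‖ ^ 2 / 2) - 1 - W g y| ∂(gaussianMeasure e q) := by
          rw [← Real.norm_eq_abs]
          refine norm_integral_le_of_norm_le (hrem.const_mul M) (Eventually.of_forall fun y => ?_)
          rw [← sub_mul, ← sub_mul, Real.norm_eq_abs, abs_mul, mul_comm]
          exact mul_le_mul_of_nonneg_right (hM y) (abs_nonneg _)
      _ ≤ M * ‖g‖ ^ 2 := by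
          rw [integral_const_mul]
          exact mul_le_mul_of_nonneg_left (hW.integral_abs_remainder_le hg) hM0

end CameronMartin

/-! ### Gradients from uniform second order expansions -/

section Taylor

variable {H : Type*} [NormedAddCommGroup H] [InnerProductSpace ℝ H]
  {F : H → ℝ} {G : H → H} {K δ : ℝ}

/-- If the first order expansions of `F` with gradient `G` have a quadratic remainder, uniformly in
the base point, then `G` is continuous: compare three expansions of `F (x + h + k)`. -/
theorem continuous_of_abs_le (hδ : 0 < δ)
    (h : ∀ x k : H, ‖k‖ ≤ δ → |F (x + k) - F x - inner ℝ (G x) k| ≤ K * ‖k‖ ^ 2) :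
    Continuous G := by
  have key : ∀ x k : H, ‖k‖ ≤ δ / 2 → ‖G (x + k) - G x‖ ≤ 6 * K * ‖k‖ := by
    intro x k hk
    rcases eq_or_ne k 0 with rfl | hk0
    · simp
    rcases eq_or_ne (G (x + k) - G x) 0 with hD | hD
    · rw [hD, norm_zero]
      have hK : 0 ≤ K * ‖k‖ ^ 2 := (abs_nonneg _).trans (h x k (by linarith))
      have : 0 ≤ K := nonneg_of_mul_nonneg_left hK (by positivity)
      positivity
    set D := G (x + k) - G x with hDdef
    have hkpos : 0 < ‖k‖ := norm_pos_iff.2 hk0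
    have hDpos : 0 < ‖D‖ := norm_pos_iff.2 hD
    -- the direction of `D`, scaled to the length of `k`
    set w : H := (‖k‖ / ‖D‖) • D with hw
    have hwn : ‖w‖ = ‖k‖ := by
      rw [hw, norm_smul, Real.norm_of_nonneg (by positivity)]
      field_simp
    have hkw : ‖k + w‖ ≤ 2 * ‖k‖ := (norm_add_le _ _).trans (by rw [hwn]; linarith)
    have hin : inner ℝ D w = ‖k‖ * ‖D‖ := by
      rw [hw, real_inner_smul_right, real_inner_self_eq_norm_sq]
      field_simp
    have h1 := abs_le.1 (h (x + k) w (by rw [hwn]; linarith))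
    have h2 := abs_le.1 (h x (k + w) (by linarith))
    have h3 := abs_le.1 (h x k (by linarith))
    rw [← add_assoc, inner_add_right] at h2
    rw [hwn] at h1
    have hK : 0 ≤ K := by
      have := (abs_nonneg _).trans (h x k (by linarith))
      exact nonneg_of_mul_nonneg_left this (by positivity)
    have h4 : K * ‖k + w‖ ^ 2 ≤ K * (2 * ‖k‖) ^ 2 := by gcongr
    have h5 : inner ℝ D w = inner ℝ (G (x + k)) w - inner ℝ (G x) w := by
      rw [hDdef, inner_sub_left]
    have h6 : ‖k‖ * ‖D‖ ≤ ‖k‖ * (6 * K * ‖k‖) := by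
      rw [← hin, h5]
      nlinarith [h1.1, h1.2, h2.1, h2.2, h3.1, h3.2]
    exact le_of_mul_le_mul_left h6 hkpos
  rw [continuous_iff_continuousAt]
  intro x
  rw [ContinuousAt, tendsto_iff_norm_sub_tendsto_zero]
  have hlim : Tendsto (fun y : H => 6 * K * ‖y - x‖) (𝓝 x) (𝓝 0) := by
    have : Continuous fun y : H => 6 * K * ‖y - x‖ := by fun_prop
    simpa using this.tendsto x
  refine squeeze_zero' (Eventually.of_forall fun y => norm_nonneg _) ?_ hlim
  filter_upwards [Metric.closedBall_mem_nhds x (half_pos hδ)] with y hy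
  rw [mem_closedBall_iff_norm] at hy
  simpa using key x (y - x) hy

theorem hasGradientAt_of_abs_le [CompleteSpace H] (hδ : 0 < δ)
    (h : ∀ x k : H, ‖k‖ ≤ δ → |F (x + k) - F x - inner ℝ (G x) k| ≤ K * ‖k‖ ^ 2) (x : H) :
    HasGradientAt F (G x) x := by
  rw [hasGradientAt_iff_isLittleO_nhds_zero]
  have hO : (fun k : H => F (x + k) - F x - inner ℝ (G x) k) =O[𝓝 0] fun k : H => ‖k‖ ^ 2 := by
    refine Asymptotics.IsBigO.of_bound K ?_
    filter_upwards [Metric.closedBall_mem_nhds (0 : H) hδ] with k hk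
    rw [mem_closedBall_zero_iff] at hk
    simpa using h x k hk
  exact hO.trans_isLittleO (Asymptotics.isLittleO_norm_pow_id one_lt_two)

end Taylor

/-! ### Estimates of the multipliers -/

section Multipliers

theorem le_C₁ {u : ℝ} (hu : 0 < u) :
    √2 * (u * Real.exp (-u ^ 2) / √(1 - Real.exp (-2 * u ^ 2))) ≤ C₁ := by
  refine mul_le_mul_of_nonneg_left (le_csSup ⟨1, ?_⟩ (mem_image_of_mem _ (mem_Ioi.2 hu)))
    (Real.sqrt_nonneg _)
  rintro _ ⟨v, hv, rfl⟩
  rw [mem_Ioi] at hv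
  refine div_le_one_of_le₀ (Real.le_sqrt_of_sq_le ?_) (Real.sqrt_nonneg _)
  have h1 : Real.exp (-v ^ 2) ^ 2 = Real.exp (-2 * v ^ 2) := by
    rw [← Real.exp_nat_mul]; congr 1; push_cast; ring
  have h2 : Real.exp (-2 * v ^ 2) * Real.exp (2 * v ^ 2) = 1 := by
    rw [← Real.exp_add, ← Real.exp_zero]; congr 1; ring
  have h3 := Real.add_one_le_exp (2 * v ^ 2)
  have h4 := Real.exp_pos (-2 * v ^ 2)
  rw [mul_pow, h1]
  nlinarith

theorem C₁_nonneg : 0 ≤ C₁ := le_trans (by positivity) (le_C₁ one_pos)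

variable {lam : ℕ → ℝ}

theorem covEigenvalue_pos (hlam : ∀ k, 0 < lam k) {t : ℝ} (ht : 0 < t) (k : ℕ) :
    0 < covEigenvalue lam t k := by
  have h := hlam k
  have := mul_pos h ht
  exact div_pos (sub_pos.2 (Real.exp_lt_one_iff.2 (by linarith))) (by positivity)

theorem covEigenvalue_nonneg (hlam : ∀ k, 0 < lam k) {t : ℝ} (ht : 0 ≤ t) (k : ℕ) :
    0 ≤ covEigenvalue lam t k := by
  have h := hlam k
  refine div_nonneg (sub_nonneg.2 (Real.exp_le_one_iff.2 ?_)) (by positivity)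
  have := mul_nonneg h.le ht
  linarith

theorem summable_covEigenvalue (hlam : ∀ k, 0 < lam k) (hs : Summable fun k => (lam k)⁻¹) {t : ℝ}
    (ht : 0 ≤ t) : Summable (covEigenvalue lam t) := by
  refine Summable.of_nonneg_of_le (covEigenvalue_nonneg hlam ht) (fun k => ?_) hs
  have h := hlam k
  rw [covEigenvalue, inv_eq_one_div, div_le_div_iff₀ (by positivity) h]
  have := Real.exp_pos (-2 * lam k * t)
  nlinarith

theorem abs_exp_neg_mul_le_one (hlam : ∀ k, 0 < lam k) {t : ℝ} (ht : 0 ≤ t) (k : ℕ) :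
    |Real.exp (-lam k * t)| ≤ 1 := by
  rw [Real.abs_exp, Real.exp_le_one_iff]
  have := mul_nonneg (hlam k).le ht
  linarith

/-- The eigenvalues of the operator `Q_t^{-1/2} e^{tA}`. -/
noncomputable def smoothing (lam : ℕ → ℝ) (t : ℝ) (k : ℕ) : ℝ :=
  Real.exp (-lam k * t) / √(covEigenvalue lam t k)

theorem smoothing_nonneg (t : ℝ) (k : ℕ) : 0 ≤ smoothing lam t k :=
  div_nonneg (Real.exp_nonneg _) (Real.sqrt_nonneg _)

theorem smoothing_eq (hlam : ∀ k, 0 < lam k) {t : ℝ} (k : ℕ) :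
    smoothing lam t k
      = √(2 * lam k) * Real.exp (-lam k * t) / √(1 - Real.exp (-2 * lam k * t)) := by
  rw [smoothing, covEigenvalue, Real.sqrt_div' _ (by have := hlam k; positivity)]
  rw [div_div_eq_mul_div, mul_comm]

theorem abs_smoothing_le (hlam : ∀ k, 0 < lam k) {t : ℝ} (ht : 0 < t) (k : ℕ) :
    |smoothing lam t k| ≤ C₁ / √t := by
  rw [abs_of_nonneg (smoothing_nonneg t k), le_div_iff₀ (Real.sqrt_pos.2 ht), smoothing_eq hlam]
  have hp : 0 < lam k * t := mul_pos (hlam k) ht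
  refine le_trans (le_of_eq ?_) (le_C₁ (Real.sqrt_pos.2 hp))
  rw [Real.sq_sqrt hp.le, Real.sqrt_mul zero_le_two, Real.sqrt_mul (hlam k).le]
  have h1 : -(lam k * t) = -lam k * t := by ring
  have h2 : -2 * (lam k * t) = -2 * lam k * t := by ring
  rw [h1, h2]
  ring

theorem four_mul_cube_add_one_le_exp {v : ℝ} (hv : 0 ≤ v) : 4 * v ^ 3 + 1 ≤ Real.exp (2 * v) := by
  have h := Real.sum_le_exp_of_nonneg (x := 2 * v) (by positivity) 5
  simp only [Finset.sum_range_succ, Finset.sum_range_zero, Nat.factorial] at h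
  norm_num at h
  -- the remaining quartic polynomial is minimal near `2 v = 4.4`
  nlinarith [mul_nonneg hv (mul_nonneg hv (sq_nonneg (v - 2.2))), mul_nonneg hv hv,
    mul_nonneg hv (sq_nonneg (v - 2.2)), sq_nonneg (v * (v - 2.2)),
    mul_nonneg hv (sq_nonneg (v - 2))]

/-- With `R` the right hand square root, the two summands of the left side are at most
`R · √v e^{-v} · p ≤ R p / 2` and `p √(v³ e^{-2v}) ≤ p R / 2`. -/
theorem one_sub_exp_mul_sqrt_le {p v : ℝ} (hp0 : 0 < p) (hv0 : 0 < v) :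
    (1 - Real.exp (-p)) * (√v * Real.exp (-v)) * (v + p)
      ≤ p * √(1 - Real.exp (-2 * (v + p))) := by
  set R := √(1 - Real.exp (-2 * (v + p))) with hR
  have hR0 : 0 ≤ R := Real.sqrt_nonneg _
  have hsv2 : √v ^ 2 = v := Real.sq_sqrt hv0.le
  have hxp := Real.add_one_le_exp (-p)
  have hxp1 : Real.exp (-p) < 1 := Real.exp_lt_one_iff.2 (by linarith)
  have hE2 : Real.exp (-v) ^ 2 * Real.exp (2 * v) = 1 := by
    rw [← Real.exp_nat_mul, ← Real.exp_add, ← Real.exp_zero]; congr 1; push_cast; ring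
  have hEpos : 0 < Real.exp (-v) ^ 2 := by positivity
  have hA : 1 - Real.exp (-p) ≤ R := by
    refine Real.le_sqrt_of_sq_le ?_
    have : Real.exp (-2 * (v + p)) ≤ Real.exp (-p) := Real.exp_le_exp.2 (by linarith)
    nlinarith [Real.exp_pos (-p)]
  have hA' : √v * Real.exp (-v) ≤ 1 / 2 := by
    refine abs_le_of_sq_le_sq' ?_ (by norm_num) |>.2
    rw [mul_pow, hsv2]
    have h1 : 4 * v ≤ Real.exp (2 * v) := by
      have := Real.quadratic_le_exp_of_nonneg (x := 2 * v) (by positivity)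
      nlinarith [sq_nonneg (v - 1 / 2)]
    nlinarith [mul_le_mul_of_nonneg_left h1 hEpos.le]
  have hB : v * (√v * Real.exp (-v)) ≤ 1 / 2 * R := by
    have h1 : 1 / 2 * R = √(1 / 4 * (1 - Real.exp (-2 * (v + p)))) := by
      rw [Real.sqrt_mul (by norm_num), show (1 / 4 : ℝ) = (1 / 2) ^ 2 by norm_num,
        Real.sqrt_sq (by norm_num)]
    rw [h1]
    refine Real.le_sqrt_of_sq_le ?_
    rw [mul_pow, mul_pow, hsv2]
    have h2 := mul_le_mul_of_nonneg_left (four_mul_cube_add_one_le_exp hv0.le) hEpos.le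
    have h3 : Real.exp (-2 * (v + p)) ≤ Real.exp (-v) ^ 2 := by
      rw [← Real.exp_nat_mul]
      refine Real.exp_le_exp.2 ?_
      push_cast
      linarith
    nlinarith
  have h1 : (1 - Real.exp (-p)) * (√v * Real.exp (-v)) ≤ R * (1 / 2) :=
    mul_le_mul hA hA' (by positivity) hR0
  have h2 : (1 - Real.exp (-p)) * (v * (√v * Real.exp (-v))) ≤ p * (1 / 2 * R) :=
    mul_le_mul (by linarith) hB (by positivity) hp0.le
  nlinarith [mul_le_mul_of_nonneg_left h1 hp0.le]

/-- The multiplier bound behind the Hölder estimate. -/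
theorem one_sub_exp_mul_le {a s t : ℝ} (ha : 0 < a) (hs : 0 < s) (ht : 0 < t) :
    (1 - Real.exp (-a * s)) * Real.exp (-a * t) * √(2 * a)
        / √(1 - Real.exp (-2 * a * (t + s)))
      ≤ √2 * (s / (√t * (t + s))) := by
  have hmain := one_sub_exp_mul_sqrt_le (mul_pos ha hs) (mul_pos ha ht)
  have e1 : -(a * s) = -a * s := by ring
  have e2 : -(a * t) = -a * t := by ring
  have e3 : -2 * (a * t + a * s) = -2 * a * (t + s) := by ring
  rw [Real.sqrt_mul ha.le, e1, e2, e3] at hmain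
  have hp : 0 < a * (t + s) := mul_pos ha (by linarith)
  have hlt : Real.exp (-2 * a * (t + s)) < 1 := Real.exp_lt_one_iff.2 (by linarith)
  have hR0 : 0 < √(1 - Real.exp (-2 * a * (t + s))) := Real.sqrt_pos.2 (by linarith)
  have hst : 0 < √t := Real.sqrt_pos.2 ht
  have hts : 0 < √t * (t + s) := mul_pos hst (by linarith)
  rw [← mul_div_assoc, div_le_div_iff₀ hR0 hts, Real.sqrt_mul zero_le_two]
  refine le_of_mul_le_mul_left ?_ ha
  have := mul_le_mul_of_nonneg_left hmain (Real.sqrt_nonneg 2)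
  linarith

end Multipliers

/-! ### The Ornstein-Uhlenbeck semigroup without drift -/

section Semigroup

variable {H : Type*} [NormedAddCommGroup H] [InnerProductSpace ℝ H] [CompleteSpace H]
  (e : HilbertBasis ℕ ℝ H) {lam : ℕ → ℝ}

theorem semigroup_zero (x : H) : semigroup e lam 0 x = x := by
  have hb : ∀ k, |Real.exp (-lam k * 0)| ≤ 1 := by simp
  refine ext_inner_basis e fun k => ?_
  rw [semigroup, inner_diagOp e hb]
  simp

variable (hlam : ∀ k, 0 < lam k)
include hlam

theorem semigroup_add {t : ℝ} (ht : 0 ≤ t) (x y : H) :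
    semigroup e lam t (x + y) = semigroup e lam t x + semigroup e lam t y :=
  map_add (diagL e (abs_exp_neg_mul_le_one hlam ht)) x y

theorem semigroup_semigroup {s t : ℝ} (h0 : 0 ≤ s) (ht : 0 ≤ t) (x : H) :
    semigroup e lam t (semigroup e lam s x) = semigroup e lam (s + t) x := by
  refine ext_inner_basis e fun k => ?_
  simp only [semigroup]
  rw [inner_diagOp e (abs_exp_neg_mul_le_one hlam ht),
    inner_diagOp e (abs_exp_neg_mul_le_one hlam h0),
    inner_diagOp e (abs_exp_neg_mul_le_one hlam (add_nonneg h0 ht)), ← mul_assoc, ← Real.exp_add]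
  congr 2
  ring

theorem sqrt_cov_smoothing {t : ℝ} (ht : 0 < t) (hs : Summable fun k => (lam k)⁻¹) (x : H) :
    diagOp e (fun k => √(covEigenvalue lam t k)) (diagOp e (smoothing lam t) x)
      = semigroup e lam t x := by
  refine ext_inner_basis e fun k => ?_
  rw [inner_diagOp e (abs_sqrt_le_sqrt_tsum (covEigenvalue_nonneg hlam ht.le)
      (summable_covEigenvalue hlam hs ht.le)), inner_diagOp e (abs_smoothing_le hlam ht),
    semigroup, inner_diagOp e (abs_exp_neg_mul_le_one hlam ht.le), smoothing, ← mul_assoc,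
    mul_div_cancel₀ _ (Real.sqrt_pos.2 (covEigenvalue_pos hlam ht k)).ne']

end Semigroup

section Transition

variable {H : Type*} [NormedAddCommGroup H] [InnerProductSpace ℝ H] [MeasurableSpace H]

/-- The Ornstein-Uhlenbeck semigroup `P_t^{(z)}` for `z = 0`. -/
noncomputable def transition {E : Type*} [NormedAddCommGroup E] [NormedSpace ℝ E]
    (e : HilbertBasis ℕ ℝ H) (lam : ℕ → ℝ) (t : ℝ) (f : H → E) (x : H) : E :=
  ∫ y, f (semigroup e lam t x + y) ∂(gaussianMeasure e (covEigenvalue lam t))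

variable [CompleteSpace H] [BorelSpace H] (e : HilbertBasis ℕ ℝ H) {lam : ℕ → ℝ}
  {E : Type*} [NormedAddCommGroup E] [NormedSpace ℝ E]

theorem transition_zero [CompleteSpace E] (f : H → E) (hf : StronglyMeasurable f) (x : H) :
    transition e lam 0 f x = f x := by
  have h : covEigenvalue lam 0 = 0 := by funext k; simp [covEigenvalue]
  rw [transition, h, gaussianMeasure_zero, semigroup_zero]
  have hfm : StronglyMeasurable fun y => f (x + y) := hf.comp_measurable (by fun_prop)
  rw [integral_dirac' _ _ hfm]
  simp

theorem norm_transition_le {f : H → E} {M : ℝ} (hM : ∀ x, ‖f x‖ ≤ M) (t : ℝ) (x : H) :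
    ‖transition e lam t f x‖ ≤ M := by
  simpa [transition] using norm_integral_le_of_norm_le_const
    (μ := gaussianMeasure e (covEigenvalue lam t))
    (Eventually.of_forall fun y => hM (semigroup e lam t x + y))

theorem measurable_semigroup :
    Measurable fun p : ℝ × H => semigroup e lam p.1 p.2 := by
  refine (measurable_tsum_smul_basis e).comp (measurable_pi_lambda _ fun k => ?_)
  exact Measurable.mul (by fun_prop) (by fun_prop)

/-- Joint measurability in time and space, from the representation of all the Gaussian measures as
images of the standard one. -/
theorem stronglyMeasurable_transition {f : H → E} (hf : StronglyMeasurable f) :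
    StronglyMeasurable fun p : ℝ × H => transition e lam p.1 f p.2 := by
  have := separableSpace_of_hilbertBasis e
  have : SecondCountableTopology H := UniformSpace.secondCountable_of_separable H
  have h1 : ∀ p : ℝ × H, transition e lam p.1 f p.2
      = ∫ w, f (semigroup e lam p.1 p.2 + ∑' k, (√(covEigenvalue lam p.1 k) * w k) • e k)
          ∂stdGaussian := by
    intro p
    have hm : Measurable fun w : ℕ → ℝ => ∑' k, (√(covEigenvalue lam p.1 k) * w k) • e k :=
      (measurable_tsum_smul_basis e).comp (by fun_prop)
    have hfm : StronglyMeasurable fun y => f (semigroup e lam p.1 p.2 + y) :=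
      hf.comp_measurable (by fun_prop)
    rw [transition, gaussianMeasure_eq_map, integral_map hm.aemeasurable hfm.aestronglyMeasurable]
  simp_rw [h1]
  have hm : Measurable fun r : (ℝ × H) × (ℕ → ℝ) => semigroup e lam r.1.1 r.1.2
      + ∑' k, (√(covEigenvalue lam r.1.1 k) * r.2 k) • e k := by
    refine Measurable.add ((measurable_semigroup e).comp measurable_fst) ?_
    refine (measurable_tsum_smul_basis e).comp (measurable_pi_lambda _ fun k => ?_)
    unfold covEigenvalue
    fun_prop
  exact (hf.comp_measurable hm).integral_prod_right'

theorem stronglyMeasurable_transition_apply {f : H → E} (hf : StronglyMeasurable f) (t : ℝ) :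
    StronglyMeasurable (transition e lam t f) :=
  (stronglyMeasurable_transition (lam := lam) e hf).comp_measurable
    (measurable_prodMk_left (x := t))

section Positive

variable (hlam : ∀ k, 0 < lam k) (hs : Summable fun k => (lam k)⁻¹)
include hlam

/-- The gradient of `P_s g` for a `C¹` function `g` with bounded gradient. -/
theorem hasGradientAt_transition {s : ℝ} (h0 : 0 ≤ s) {g : H → ℝ} {g' : H → H} {B M : ℝ}
    (hg : Measurable g) (hgM : ∀ x, |g x| ≤ M) (hg' : ∀ x, HasGradientAt g (g' x) x)
    (hgc : Continuous g') (hB : ∀ x, ‖g' x‖ ≤ B) (x : H) :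
    HasGradientAt (transition e lam s g) (semigroup e lam s (transition e lam s g' x)) x := by
  have := separableSpace_of_hilbertBasis e
  have : SecondCountableTopology H := UniformSpace.secondCountable_of_separable H
  have hb := abs_exp_neg_mul_le_one hlam h0
  set S : H →L[ℝ] H := diagL e hb with hS
  set F' : H → H → H →L[ℝ] ℝ := fun x y =>
    (innerSL ℝ (g' (S x + y))).comp S with hF'
  have hcont : ∀ x, Continuous (F' x) := by
    intro x
    have h1 : Continuous fun y => innerSL ℝ (g' (S x + y)) :=
      (innerSL ℝ).continuous.comp (hgc.comp (by fun_prop))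
    exact h1.clm_comp continuous_const
  have hbound : ∀ x y, ‖F' x y‖ ≤ B * ‖S‖ := fun x y => by
    refine (ContinuousLinearMap.opNorm_comp_le _ _).trans ?_
    rw [innerSL_apply_norm]
    exact mul_le_mul_of_nonneg_right (hB _) (norm_nonneg _)
  have hd := hasFDerivAt_integral_of_dominated_of_fderiv_le
    (μ := gaussianMeasure e (covEigenvalue lam s)) (F := fun x y => g (S x + y)) (F' := F')
    (x₀ := x) (s := univ) (bound := fun _ => B * ‖S‖) univ_mem
    (Eventually.of_forall fun x => (hg.comp (by fun_prop)).aestronglyMeasurable)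
    (Integrable.of_bound (hg.comp (by fun_prop)).aestronglyMeasurable M
      (Eventually.of_forall fun y => hgM _))
    (hcont x).aestronglyMeasurable
    (Eventually.of_forall fun y x _ => hbound x y) (integrable_const _)
    (Eventually.of_forall fun y x _ => by
      have h1 := (hg' (S x + y)).hasFDerivAt.comp x (S.hasFDerivAt.add_const y)
      exact h1)
  rw [hasGradientAt_iff_hasFDerivAt]
  have hint : Integrable (F' x) (gaussianMeasure e (covEigenvalue lam s)) :=
    Integrable.of_bound (hcont x).aestronglyMeasurable _
      (Eventually.of_forall fun y => hbound x y)
  have hint' : Integrable (fun y => g' (semigroup e lam s x + y))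
      (gaussianMeasure e (covEigenvalue lam s)) :=
    Integrable.of_bound (hgc.comp (by fun_prop)).aestronglyMeasurable B
      (Eventually.of_forall fun y => hB _)
  refine hd.congr_fderiv ?_
  ext h
  rw [ContinuousLinearMap.integral_apply hint, InnerProductSpace.toDual_apply_apply, semigroup,
    inner_diagOp_comm e hb, real_inner_comm, transition, ← integral_inner hint']
  refine integral_congr_ae (Eventually.of_forall fun y => ?_)
  simp only [hF', ContinuousLinearMap.comp_apply, innerSL_apply_apply]
  exact real_inner_comm _ _

include hs

/-- The semigroup law. -/
theorem transition_transition {s t : ℝ} (h0 : 0 ≤ s) (ht : 0 ≤ t) {f : H → ℝ} (hf : Measurable f)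
    {M : ℝ} (hM : ∀ x, |f x| ≤ M) (x : H) :
    transition e lam s (transition e lam t f) x = transition e lam (s + t) f x := by
  have := separableSpace_of_hilbertBasis e
  have : SecondCountableTopology H := UniformSpace.secondCountable_of_separable H
  have hb := abs_exp_neg_mul_le_one hlam ht
  have hcov : covEigenvalue lam (s + t) = fun k =>
      Real.exp (-lam k * t) ^ 2 * covEigenvalue lam s k + covEigenvalue lam t k := by
    funext k
    have h1 : Real.exp (-2 * lam k * (s + t))
        = Real.exp (-lam k * t) ^ 2 * Real.exp (-2 * lam k * s) := by
      rw [← Real.exp_nat_mul, ← Real.exp_add]; congr 1; push_cast; ring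
    have h2 : Real.exp (-2 * lam k * t) = Real.exp (-lam k * t) ^ 2 := by
      rw [← Real.exp_nat_mul]; congr 1; push_cast; ring
    have h3 := (hlam k).ne'
    simp only [covEigenvalue]
    rw [h1, h2]
    field_simp
    ring
  have hm : Measurable fun p : H × H => semigroup e lam t p.1 + p.2 :=
    ((diagL e hb).continuous.measurable.comp measurable_fst).add measurable_snd
  have hint : Integrable (fun p : H × H =>
      f (semigroup e lam (s + t) x + (semigroup e lam t p.1 + p.2)))
      ((gaussianMeasure e (covEigenvalue lam s)).prod
        (gaussianMeasure e (covEigenvalue lam t))) :=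
    Integrable.of_bound (hf.comp (hm.const_add _)).aestronglyMeasurable M
      (Eventually.of_forall fun p => hM _)
  have hgm : gaussianMeasure e (covEigenvalue lam (s + t))
      = ((gaussianMeasure e (covEigenvalue lam s)).prod
        (gaussianMeasure e (covEigenvalue lam t))).map
          fun p => semigroup e lam t p.1 + p.2 := by
    rw [hcov]
    exact (map_prod_gaussianMeasure e (covEigenvalue_nonneg hlam h0)
      (summable_covEigenvalue hlam hs h0) (covEigenvalue_nonneg hlam ht)
      (summable_covEigenvalue hlam hs ht) hb).symm
  have hfm : Measurable fun y => f (semigroup e lam (s + t) x + y) := hf.comp (by fun_prop)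
  rw [transition, transition, hgm, integral_map hm.aemeasurable hfm.aestronglyMeasurable,
    integral_prod _ hint]
  refine integral_congr_ae (Eventually.of_forall fun y => ?_)
  simp only [transition]
  refine integral_congr_ae (Eventually.of_forall fun y' => ?_)
  simp only
  rw [semigroup_add e hlam ht, semigroup_semigroup e hlam h0 ht, add_assoc]

/-- `P_t f` is of class `C¹` for `t > 0`, with gradient in the image of the ball of radius `sup |f|`
under `Q_t^{-1/2} e^{tA}`: a shift of `x` by `k` shifts the Gaussian variable by
`e^{tA} k = Q_t^{1/2} (Q_t^{-1/2} e^{tA} k)`. -/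
theorem exists_gradient_transition {t : ℝ} (ht : 0 < t) {f : H → ℝ} (hf : Measurable f) {M : ℝ}
    (hM : ∀ x, |f x| ≤ M) :
    (∀ x, HasGradientAt (transition e lam t f) (gradient (transition e lam t f) x) x) ∧
    Continuous (gradient (transition e lam t f)) ∧
    ∀ x, ∃ m : H, ‖m‖ ≤ M ∧ gradient (transition e lam t f) x = diagOp e (smoothing lam t) m := by
  have hq := covEigenvalue_pos hlam ht
  have hqs := summable_covEigenvalue hlam hs ht.le
  have hb := abs_smoothing_le hlam ht
  have hM0 : 0 ≤ M := (abs_nonneg _).trans (hM 0)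
  have hex : ∀ x : H, ∃ m : H, ‖m‖ ≤ M ∧ ∀ g : H, ‖g‖ ≤ 1 →
      |∫ y, f (semigroup e lam t x + (y + diagOp e (fun k => √(covEigenvalue lam t k)) g))
          ∂(gaussianMeasure e (covEigenvalue lam t))
        - transition e lam t f x - inner ℝ m g| ≤ M * ‖g‖ ^ 2 := fun x =>
    exists_gradient_integral_shift e hq hqs (φ := fun y => f (semigroup e lam t x + y))
      (hf.comp (by fun_prop)) fun y => hM _
  choose m hmM hm using hex
  -- shifts of length at most `δ` are mapped into the unit ball by `Q_t^{-1/2} e^{tA}`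
  set δ : ℝ := (C₁ / √t + 1)⁻¹ with hδ
  have hC : 0 ≤ C₁ / √t := div_nonneg C₁_nonneg (Real.sqrt_nonneg _)
  have hδ0 : 0 < δ := by positivity
  have htaylor : ∀ x k : H, ‖k‖ ≤ δ →
      |transition e lam t f (x + k) - transition e lam t f x
        - inner ℝ (diagOp e (smoothing lam t) (m x)) k| ≤ M * (C₁ / √t) ^ 2 * ‖k‖ ^ 2 := by
    intro x k hk
    have hgn := norm_diagOp_le e hb k
    have hg1 : ‖diagOp e (smoothing lam t) k‖ ≤ 1 := by
      calc ‖diagOp e (smoothing lam t) k‖ ≤ C₁ / √t * ‖k‖ := hgn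
        _ ≤ (C₁ / √t + 1) * δ := by gcongr; linarith
        _ = 1 := mul_inv_cancel₀ (by positivity)
    have h1 := hm x _ hg1
    rw [sqrt_cov_smoothing e hlam ht hs, ← inner_diagOp_comm e hb] at h1
    have h2 : transition e lam t f (x + k)
        = ∫ y, f (semigroup e lam t x + (y + semigroup e lam t k))
          ∂(gaussianMeasure e (covEigenvalue lam t)) := by
      rw [transition, semigroup_add e hlam ht.le]
      congr 1
      funext y
      congr 1
      abel
    rw [h2]
    refine h1.trans ?_
    rw [mul_assoc, ← mul_pow]
    gcongr
  have hgrad := hasGradientAt_of_abs_le hδ0 htaylor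
  have heq : ∀ x, gradient (transition e lam t f) x = diagOp e (smoothing lam t) (m x) :=
    fun x => (hgrad x).gradient
  refine ⟨fun x => by rw [heq]; exact hgrad x, ?_, fun x => ⟨m x, hmM x, heq x⟩⟩
  rw [funext heq]
  exact continuous_of_abs_le hδ0 htaylor

theorem norm_gradient_transition_le {t : ℝ} (ht : 0 < t) {f : H → ℝ} (hf : Measurable f) {M : ℝ}
    (hM : ∀ x, |f x| ≤ M) (x : H) : ‖gradient (transition e lam t f) x‖ ≤ C₁ / √t * M := by
  obtain ⟨m, hm, h⟩ := (exists_gradient_transition e hlam hs ht hf hM).2.2 x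
  rw [h]
  refine (norm_diagOp_le e (abs_smoothing_le hlam ht) m).trans ?_
  exact mul_le_mul_of_nonneg_left hm (div_nonneg C₁_nonneg (Real.sqrt_nonneg _))

/-- Joint measurability of the gradient, as a limit of difference quotients. -/
theorem measurable_gradient_transition {f : H → ℝ} (hf : Measurable f) {M : ℝ}
    (hM : ∀ x, |f x| ≤ M) :
    Measurable fun p : ℝ × H =>
      (Ioi (0 : ℝ)).indicator (fun t => gradient (transition e lam t f) p.2) p.1 := by
  have := separableSpace_of_hilbertBasis e
  have : SecondCountableTopology H := UniformSpace.secondCountable_of_separable H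
  have hT := (stronglyMeasurable_transition (lam := lam) e hf.stronglyMeasurable).measurable
  refine measurable_of_inner_basis e fun k => ?_
  refine measurable_of_tendsto_metrizable (f := fun (n : ℕ) (p : ℝ × H) =>
    ({p : ℝ × H | 0 < p.1}).indicator (fun p => ((n : ℝ) + 1) *
      (transition e lam p.1 f (p.2 + ((n : ℝ) + 1)⁻¹ • e k) - transition e lam p.1 f p.2)) p)
    (fun n => ?_) ?_
  · refine Measurable.indicator ?_ (measurableSet_lt measurable_const measurable_fst)
    refine measurable_const.mul (Measurable.sub ?_ hT)
    exact hT.comp (measurable_fst.prodMk (measurable_snd.add_const _))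
  · rw [tendsto_pi_nhds]
    rintro ⟨t, x⟩
    by_cases ht : 0 < t
    · have hg := ((exists_gradient_transition e hlam hs ht hf hM).1 x).hasFDerivAt
      have hlim := hg.lim (e k) (c := fun n : ℕ => (n : ℝ) + 1) (l := atTop)
        (tendsto_norm_atTop_atTop.comp
          (tendsto_natCast_atTop_atTop.atTop_add tendsto_const_nhds))
      simpa [indicator, ht, real_inner_comm] using hlim
    · simp [indicator, ht]

/-- Differentiation of the semigroup law: `e^{sA} P_s D P_t f = D P_{s+t} f`. -/
theorem semigroup_transition_gradient {s t : ℝ} (h0 : 0 ≤ s) (ht : 0 < t) {f : H → ℝ}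
    (hf : Measurable f) {M : ℝ} (hM : ∀ x, |f x| ≤ M) (x : H) :
    semigroup e lam s (transition e lam s (gradient (transition e lam t f)) x)
      = gradient (transition e lam (s + t) f) x := by
  obtain ⟨hg, hgc, -⟩ := exists_gradient_transition e hlam hs ht hf hM
  have h1 := hasGradientAt_transition e hlam h0
    (stronglyMeasurable_transition_apply e hf.stronglyMeasurable t).measurable
    (fun x => norm_transition_le e (f := f) hM t x) hg hgc
    (norm_gradient_transition_le e hlam hs ht hf hM) x
  rw [funext fun x => transition_transition e hlam hs h0 ht.le hf hM x] at h1
  exact h1.gradient.symm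

/-- By `semigroup_transition_gradient`, `P_s D P_t f - D P_{t+s} f` is
`(e^{-sA} - 1) Q_{t+s}^{-1/2} e^{(t+s)A} m` with `‖m‖ ≤ sup |f|`, and this operator is bounded. -/
theorem norm_transition_gradient_sub_le {s t : ℝ} (h0 : 0 < s) (ht : 0 < t) {f : H → ℝ}
    (hf : Measurable f) {M : ℝ} (hM : ∀ x, |f x| ≤ M) (x : H) :
    ‖transition e lam s (gradient (transition e lam t f)) x
        - gradient (transition e lam (s + t) f) x‖ ≤ √2 * (s / (√t * (t + s))) * M := by
  obtain ⟨m, hm, h⟩ := (exists_gradient_transition e hlam hs (add_pos h0 ht) hf hM).2.2 x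
  have hcomm := semigroup_transition_gradient e hlam hs h0.le ht hf hM x
  have hb : ∀ k, |(Real.exp (lam k * s) - 1) * smoothing lam (s + t) k|
      ≤ √2 * (s / (√t * (t + s))) := by
    intro k
    have hpos := mul_pos (hlam k) h0
    rw [abs_of_nonneg (mul_nonneg (sub_nonneg.2 (Real.one_le_exp hpos.le)) (smoothing_nonneg _ _))]
    refine le_trans (le_of_eq ?_) (one_sub_exp_mul_le (hlam k) h0 ht)
    rw [smoothing_eq hlam, add_comm s t, ← mul_div_assoc]
    congr 1
    have h2 : Real.exp (-lam k * (t + s)) = Real.exp (-lam k * t) * Real.exp (-lam k * s) := by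
      rw [← Real.exp_add]; congr 1; ring
    have h3 : Real.exp (lam k * s) * Real.exp (-lam k * s) = 1 := by
      rw [← Real.exp_add, ← Real.exp_zero]; congr 1; ring
    rw [h2]
    linear_combination (√(2 * lam k) * Real.exp (-lam k * t)) * h3
  have hdiff : transition e lam s (gradient (transition e lam t f)) x
      - gradient (transition e lam (s + t) f) x
      = diagOp e (fun k => (Real.exp (lam k * s) - 1) * smoothing lam (s + t) k) m := by
    refine ext_inner_basis e fun k => ?_
    have h1 := congrArg (fun v => inner ℝ (e k) v) hcomm
    simp only [semigroup] at h1
    rw [inner_diagOp e (abs_exp_neg_mul_le_one hlam h0.le)] at h1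
    rw [inner_diagOp e hb, inner_sub_right]
    rw [h, inner_diagOp e (abs_smoothing_le hlam (add_pos h0 ht))] at h1 ⊢
    have h3 : Real.exp (lam k * s) * Real.exp (-lam k * s) = 1 := by
      rw [← Real.exp_add, ← Real.exp_zero]; congr 1; ring
    linear_combination Real.exp (lam k * s) * h1
      - inner ℝ (e k) (transition e lam s (gradient (transition e lam t f)) x) * h3
  rw [hdiff]
  exact (norm_diagOp_le e hb m).trans (mul_le_mul_of_nonneg_left hm (by positivity))

end Positive

end Transition

/-! ### Elementary integrals in time -/

section TimeIntegrals

theorem setIntegral_comp_add_right {E : Type*} [NormedAddCommGroup E] [NormedSpace ℝ E]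
    (F : ℝ → E) (s : ℝ) : ∫ t in Ioi 0, F (t + s) = ∫ t in Ioi s, F t := by
  have h := (measurePreserving_add_right volume s).setIntegral_preimage_emb
    (measurableEmbedding_addRight s) F (Ioi s)
  simpa using h

theorem IntegrableOn.comp_add_right {E : Type*} [NormedAddCommGroup E]
    {F : ℝ → E} {s : ℝ} (hF : IntegrableOn F (Ioi s)) :
    IntegrableOn (fun t => F (t + s)) (Ioi 0) := by
  have h := ((measurePreserving_add_right volume s).integrableOn_comp_preimage
    (measurableEmbedding_addRight s)).2 hF
  simpa [Function.comp_def] using h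

/-- The antiderivative is `2 √s arctan √(t / s)`. -/
theorem integrableOn_and_integral_div_sqrt_mul {s : ℝ} (hs : 0 < s) :
    IntegrableOn (fun t => s / (√t * (t + s))) (Ioi 0) ∧
      ∫ t in Ioi 0, s / (√t * (t + s)) = Real.pi * √s := by
  set F : ℝ → ℝ := fun t => 2 * √s * Real.arctan √(t / s) with hF
  have hcont : ContinuousWithinAt F (Ici 0) 0 := by
    refine Continuous.continuousWithinAt ?_
    fun_prop
  have hderiv : ∀ t ∈ Ioi (0 : ℝ), HasDerivAt F (s / (√t * (t + s))) t := by
    intro t ht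
    rw [mem_Ioi] at ht
    have h1 : HasDerivAt (fun t => √(t / s)) (1 / s / (2 * √(t / s))) t :=
      ((hasDerivAt_id t).div_const s).sqrt (by positivity)
    have h2 := (h1.arctan).const_mul (2 * √s)
    refine h2.congr_deriv ?_
    have hst := Real.sqrt_pos.2 ht
    have hss := Real.sqrt_pos.2 hs
    have e1 := Real.sq_sqrt ht.le
    have e2 := Real.sq_sqrt hs.le
    rw [Real.sq_sqrt (by positivity), Real.sqrt_div ht.le]
    field_simp
    rw [e2]
    ring
  have hpos : ∀ t ∈ Ioi (0 : ℝ), 0 ≤ s / (√t * (t + s)) := by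
    intro t ht
    rw [mem_Ioi] at ht
    positivity
  have hlim : Tendsto F atTop (𝓝 (2 * √s * (Real.pi / 2))) := by
    refine Tendsto.const_mul _ ((Real.tendsto_arctan_atTop.mono_right nhdsWithin_le_nhds).comp ?_)
    exact Real.tendsto_sqrt_atTop.comp (tendsto_id.atTop_div_const hs)
  refine ⟨integrableOn_Ioi_deriv_of_nonneg hcont hderiv hpos hlim, ?_⟩
  rw [integral_Ioi_of_hasDerivAt_of_nonneg hcont hderiv hpos hlim]
  simp [hF]
  ring

theorem integrableOn_exp_neg_mul {l : ℝ} (hl : 0 < l) :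
    IntegrableOn (fun t => Real.exp (-l * t)) (Ioi 0) :=
  exp_neg_integrableOn_Ioi 0 hl

theorem integral_exp_neg_mul {l : ℝ} (hl : 0 < l) :
    ∫ t in Ioi 0, Real.exp (-l * t) = 1 / l := by
  rw [integral_exp_mul_Ioi (neg_lt_zero.2 hl)]
  simp

theorem integrableOn_exp_neg_mul_div_sqrt {l : ℝ} (hl : 0 < l) (c : ℝ) :
    IntegrableOn (fun t => Real.exp (-l * t) * (c / √t)) (Ioi 0) := by
  have h := (integrableOn_rpow_mul_exp_neg_mul_rpow (p := 1) (s := -(1 / 2)) (by norm_num) one_pos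
    hl).const_mul c
  refine IntegrableOn.congr_fun h (fun t ht => ?_) measurableSet_Ioi
  rw [mem_Ioi] at ht
  rw [Real.rpow_one, Real.rpow_neg ht.le, ← Real.sqrt_eq_rpow]
  ring

theorem integral_Ioc_div_sqrt {s : ℝ} (hs : 0 ≤ s) (c : ℝ) :
    IntegrableOn (fun t => c / √t) (Ioc 0 s) ∧ ∫ t in Ioc 0 s, c / √t = 2 * c * √s := by
  have h0 : (-1 : ℝ) < -(1 / 2) := by norm_num
  have hcongr : EqOn (fun t : ℝ => c * t ^ (-(1 / 2) : ℝ)) (fun t => c / √t) (Ioc 0 s) := by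
    intro t ht
    simp only
    rw [Real.rpow_neg ht.1.le, ← Real.sqrt_eq_rpow]
    rfl
  constructor
  · have h := (intervalIntegral.intervalIntegrable_rpow' (a := 0) (b := s) h0).const_mul c
    rw [intervalIntegrable_iff_integrableOn_Ioc_of_le hs] at h
    exact h.congr_fun hcongr measurableSet_Ioc
  · rw [← setIntegral_congr_fun measurableSet_Ioc hcongr,
      ← intervalIntegral.integral_of_le hs, intervalIntegral.integral_const_mul,
      integral_rpow (Or.inl h0), Real.sqrt_eq_rpow, Real.zero_rpow (by norm_num)]
    norm_num
    ring

end TimeIntegrals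

/-! ### The resolvent without drift -/

section Resolvent

section Gradient

variable {H : Type*} [NormedAddCommGroup H] [InnerProductSpace ℝ H] [CompleteSpace H]
  [MeasurableSpace H] (e : HilbertBasis ℕ ℝ H) {lam : ℕ → ℝ}

/-- The gradient of `P_t f`, set to zero for `t ≤ 0` so that it is jointly measurable in
`(t, x)`. -/
noncomputable def gradT (lam : ℕ → ℝ) (f : H → ℝ) (t : ℝ) (x : H) : H :=
  (Ioi (0 : ℝ)).indicator (fun t => gradient (transition e lam t f) x) t

theorem gradT_of_pos {f : H → ℝ} {t : ℝ} (ht : 0 < t) :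
    gradT e lam f t = gradient (transition e lam t f) := by
  funext x
  simp [gradT, ht]

end Gradient

variable {H : Type*} [NormedAddCommGroup H] [InnerProductSpace ℝ H] [CompleteSpace H]
  [MeasurableSpace H] [BorelSpace H] (e : HilbertBasis ℕ ℝ H) {lam : ℕ → ℝ}

/-- The resolvent `∫₀^∞ e^{-lt} P_t f dt` of the semigroup without drift. -/
noncomputable def resolvent₀ (lam : ℕ → ℝ) (l : ℝ) (f : H → ℝ) (x : H) : ℝ :=
  ∫ t in Ioi (0 : ℝ), Real.exp (-l * t) * transition e lam t f x

/-- The integral `∫₀^∞ e^{-lt} D P_t f dt`. -/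
noncomputable def resolventGrad (lam : ℕ → ℝ) (l : ℝ) (f : H → ℝ) (x : H) : H :=
  ∫ t in Ioi (0 : ℝ), Real.exp (-l * t) • gradT e lam f t x

theorem integrableOn_exp_mul_transition {f : H → ℝ} (hf : Measurable f) {M : ℝ}
    (hM : ∀ x, |f x| ≤ M) {l : ℝ} (hl : 0 < l) (x : H) :
    IntegrableOn (fun t => Real.exp (-l * t) * transition e lam t f x) (Ioi 0) := by
  have hm := ((stronglyMeasurable_transition (lam := lam) e hf.stronglyMeasurable).comp_measurable
    (measurable_prodMk_right (y := x))).measurable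
  have hm' : Measurable fun t => Real.exp (-l * t) * transition e lam t f x :=
    Measurable.mul (by fun_prop) hm
  refine Integrable.mono' ((integrableOn_exp_neg_mul hl).mul_const M) hm'.aestronglyMeasurable
    (Eventually.of_forall fun t => ?_)
  rw [norm_mul, Real.norm_of_nonneg (Real.exp_nonneg _)]
  exact mul_le_mul_of_nonneg_left (norm_transition_le e hM t x) (Real.exp_nonneg _)

theorem abs_resolvent₀_le {f : H → ℝ} {M : ℝ} (hM : ∀ x, |f x| ≤ M) {l : ℝ} (hl : 0 < l) (x : H) :
    |resolvent₀ e lam l f x| ≤ 1 / l * M := by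
  rw [← integral_exp_neg_mul hl, ← integral_mul_const, ← Real.norm_eq_abs, resolvent₀]
  refine norm_integral_le_of_norm_le ((integrableOn_exp_neg_mul hl).mul_const M)
    (Eventually.of_forall fun t => ?_)
  rw [norm_mul, Real.norm_of_nonneg (Real.exp_nonneg _)]
  exact mul_le_mul_of_nonneg_left (norm_transition_le e hM t x) (Real.exp_nonneg _)

section Positive

variable (hlam : ∀ k, 0 < lam k) (hs : Summable fun k => (lam k)⁻¹) {f : H → ℝ}
  (hf : Measurable f) {M : ℝ} (hM : ∀ x, |f x| ≤ M) {l : ℝ} (hl : 0 < l)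
include hlam hs hf hM

theorem norm_gradT_le (t : ℝ) (x : H) : ‖gradT e lam f t x‖ ≤ C₁ * M / √t := by
  rw [mul_div_right_comm]
  rcases lt_or_ge 0 t with ht | ht
  · rw [gradT_of_pos e ht]
    exact norm_gradient_transition_le e hlam hs ht hf hM x
  -- for `t ≤ 0` the right side is `C₁ * M / 0 = 0`
  · rw [Real.sqrt_eq_zero_of_nonpos ht]
    simp [gradT, ht]

theorem measurable_gradT : Measurable fun p : ℝ × H => gradT e lam f p.1 p.2 :=
  measurable_gradient_transition e hlam hs hf hM

theorem norm_exp_smul_gradT_le (l t : ℝ) (x : H) :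
    ‖Real.exp (-l * t) • gradT e lam f t x‖ ≤ Real.exp (-l * t) * (C₁ * M / √t) := by
  rw [norm_smul, Real.norm_of_nonneg (Real.exp_nonneg _)]
  exact mul_le_mul_of_nonneg_left (norm_gradT_le e hlam hs hf hM t x) (Real.exp_nonneg _)

theorem stronglyMeasurable_exp_smul_gradT (l : ℝ) (x : H) :
    StronglyMeasurable fun t => Real.exp (-l * t) • gradT e lam f t x := by
  have := separableSpace_of_hilbertBasis e
  have : SecondCountableTopology H := UniformSpace.secondCountable_of_separable H
  have h1 : Measurable fun t => gradT e lam f t x :=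
    (measurable_gradT e hlam hs hf hM).comp (measurable_prodMk_right (y := x))
  have h2 : Measurable fun t => Real.exp (-l * t) := by fun_prop
  exact (h2.smul h1).stronglyMeasurable

include hl

theorem integrableOn_exp_smul_gradT (x : H) :
    IntegrableOn (fun t => Real.exp (-l * t) • gradT e lam f t x) (Ioi 0) :=
  Integrable.mono' (integrableOn_exp_neg_mul_div_sqrt hl (C₁ * M))
    (stronglyMeasurable_exp_smul_gradT e hlam hs hf hM l x).aestronglyMeasurable
    (Eventually.of_forall fun t => norm_exp_smul_gradT_le e hlam hs hf hM l t x)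

theorem hasGradientAt_resolvent₀ (x : H) :
    HasGradientAt (resolvent₀ e lam l f) (resolventGrad e lam l f x) x := by
  have hd := hasFDerivAt_integral_of_dominated_of_fderiv_le
    (μ := volume.restrict (Ioi (0 : ℝ)))
    (F := fun x t => Real.exp (-l * t) * transition e lam t f x)
    (F' := fun x t => InnerProductSpace.toDual ℝ H (Real.exp (-l * t) • gradT e lam f t x))
    (x₀ := x) (s := univ) (bound := fun t => Real.exp (-l * t) * (C₁ * M / √t)) univ_mem
    (Eventually.of_forall fun x =>
      (integrableOn_exp_mul_transition e hf hM hl x).aestronglyMeasurable)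
    (integrableOn_exp_mul_transition e hf hM hl x)
    ((InnerProductSpace.toDual ℝ H).continuous.comp_aestronglyMeasurable
      (stronglyMeasurable_exp_smul_gradT e hlam hs hf hM l x).aestronglyMeasurable)
    (Eventually.of_forall fun t x _ => by
      rw [LinearIsometryEquiv.norm_map]
      exact norm_exp_smul_gradT_le e hlam hs hf hM l t x)
    (integrableOn_exp_neg_mul_div_sqrt hl (C₁ * M))
    (by
      filter_upwards [ae_restrict_mem measurableSet_Ioi] with t ht x _
      have h := ((exists_gradient_transition e hlam hs ht hf hM).1 x).hasFDerivAt.const_mul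
        (Real.exp (-l * t))
      rw [gradT_of_pos e ht, map_smul]
      exact h)
  rw [hasGradientAt_iff_hasFDerivAt]
  refine hd.congr_fderiv ?_
  exact ContinuousLinearMap.integral_comp_comm
    (InnerProductSpace.toDual ℝ H).toContinuousLinearEquiv.toContinuousLinearMap
    (integrableOn_exp_smul_gradT e hlam hs hf hM hl x)

theorem continuous_resolventGrad : Continuous (resolventGrad e lam l f) := by
  refine continuous_of_dominated (bound := fun t => Real.exp (-l * t) * (C₁ * M / √t))
    (fun x => (stronglyMeasurable_exp_smul_gradT e hlam hs hf hM l x).aestronglyMeasurable)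
    (fun x => Eventually.of_forall fun t => norm_exp_smul_gradT_le e hlam hs hf hM l t x)
    (integrableOn_exp_neg_mul_div_sqrt hl (C₁ * M)) ?_
  filter_upwards [ae_restrict_mem measurableSet_Ioi] with t ht
  rw [gradT_of_pos e ht]
  exact ((exists_gradient_transition e hlam hs ht hf hM).2.1).const_smul _

theorem norm_resolventGrad_le (x : H) :
    ‖resolventGrad e lam l f x‖ ≤ ∫ t in Ioi 0, Real.exp (-l * t) * (C₁ * M / √t) :=
  norm_integral_le_of_norm_le (integrableOn_exp_neg_mul_div_sqrt hl (C₁ * M))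
    (Eventually.of_forall fun t => norm_exp_smul_gradT_le e hlam hs hf hM l t x)

/-- Fubini's theorem for `P_s` applied to the gradient of the resolvent. -/
theorem transition_resolventGrad (s : ℝ) (x : H) :
    IntegrableOn (fun t => Real.exp (-l * t) • transition e lam s (gradT e lam f t) x) (Ioi 0) ∧
    transition e lam s (resolventGrad e lam l f) x
      = ∫ t in Ioi 0, Real.exp (-l * t) • transition e lam s (gradT e lam f t) x := by
  have := separableSpace_of_hilbertBasis e
  have : SecondCountableTopology H := UniformSpace.secondCountable_of_separable H
  have hmeas : Measurable fun p : H × ℝ =>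
      Real.exp (-l * p.2) • gradT e lam f p.2 (semigroup e lam s x + p.1) := by
    have h1 : Measurable fun p : H × ℝ => gradT e lam f p.2 (semigroup e lam s x + p.1) :=
      (measurable_gradT e hlam hs hf hM).comp
        (measurable_snd.prodMk (measurable_fst.const_add _))
    have h2 : Measurable fun p : H × ℝ => Real.exp (-l * p.2) := by fun_prop
    exact h2.smul h1
  have hint : Integrable (fun p : H × ℝ =>
      Real.exp (-l * p.2) • gradT e lam f p.2 (semigroup e lam s x + p.1))
      ((gaussianMeasure e (covEigenvalue lam s)).prod (volume.restrict (Ioi (0 : ℝ)))) := by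
    have hb : Integrable (fun p : H × ℝ => Real.exp (-l * p.2) * (C₁ * M / √p.2))
        ((gaussianMeasure e (covEigenvalue lam s)).prod (volume.restrict (Ioi (0 : ℝ)))) :=
      Integrable.comp_snd (f := fun t => Real.exp (-l * t) * (C₁ * M / √t))
        (integrableOn_exp_neg_mul_div_sqrt hl (C₁ * M)) _
    exact Integrable.mono' hb hmeas.aestronglyMeasurable
      (Eventually.of_forall fun p => norm_exp_smul_gradT_le e hlam hs hf hM l _ _)
  have h1 := hint.integral_prod_right
  simp only [integral_smul] at h1
  refine ⟨h1, ?_⟩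
  simp only [transition, resolventGrad]
  rw [integral_integral_swap hint]
  simp only [integral_smul]

/-- The Hölder estimate without drift: split `∫₀^∞ e^{-lt} D P_t f dt` at `s` and shift the second
part by `s`. The part below `s` contributes `2 C₁`, the difference of `P_s D P_t f` and
`D P_{t+s} f` contributes `√2 π`, and the factor `1 - e^{-ls}` in front of `D P_{t+s} f` contributes
`C₁`, uniformly in `l`. -/
theorem norm_transition_resolventGrad_sub_le {s : ℝ} (h0 : 0 < s) (x : H) :
    ‖transition e lam s (resolventGrad e lam l f) x - resolventGrad e lam l f x‖
      ≤ (√2 * Real.pi + 3 * C₁) * √s * M := by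
  have hM0 : 0 ≤ M := (abs_nonneg _).trans (hM 0)
  have hss : 0 < √s := Real.sqrt_pos.2 h0
  obtain ⟨hVint, hV⟩ := transition_resolventGrad e hlam hs hf hM hl s x
  have hUint := integrableOn_exp_smul_gradT e hlam hs hf hM hl x
  set F : ℝ → H := fun t => Real.exp (-l * t) • gradT e lam f t x with hF
  set V : ℝ → H := fun t => Real.exp (-l * t) • transition e lam s (gradT e lam f t) x with hVdef
  have hU1 : IntegrableOn F (Ioc 0 s) := hUint.mono_set Ioc_subset_Ioi_self
  have hU2 : IntegrableOn F (Ioi s) := hUint.mono_set (Ioi_subset_Ioi h0.le)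
  have hsplit : resolventGrad e lam l f x
      = (∫ t in Ioc 0 s, F t) + ∫ t in Ioi 0, F (t + s) := by
    rw [setIntegral_comp_add_right, resolventGrad, ← Ioc_union_Ioi_eq_Ioi h0.le,
      setIntegral_union (Ioc_disjoint_Ioi le_rfl)
      measurableSet_Ioi hU1 hU2]
  have hU3 : IntegrableOn (fun t => F (t + s)) (Ioi 0) := IntegrableOn.comp_add_right hU2
  have hdiff : transition e lam s (resolventGrad e lam l f) x - resolventGrad e lam l f x
      = (∫ t in Ioi 0, (V t - F (t + s))) - ∫ t in Ioc 0 s, F t := by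
    rw [hV, hsplit, integral_sub hVint hU3]
    abel
  obtain ⟨hIint, hI⟩ := integrableOn_and_integral_div_sqrt_mul h0
  obtain ⟨hJint, hJ⟩ := integral_Ioc_div_sqrt h0.le (C₁ * M)
  have hnear : ‖∫ t in Ioc 0 s, F t‖ ≤ 2 * (C₁ * M) * √s := by
    rw [← hJ]
    refine norm_integral_le_of_norm_le hJint ?_
    filter_upwards [ae_restrict_mem measurableSet_Ioc] with t ht
    refine (norm_exp_smul_gradT_le e hlam hs hf hM l t x).trans ?_
    refine mul_le_of_le_one_left (div_nonneg (mul_nonneg C₁_nonneg hM0) (Real.sqrt_nonneg _)) ?_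
    rw [Real.exp_le_one_iff]
    have := mul_pos hl ht.1
    linarith
  set c : ℝ := (1 - Real.exp (-l * s)) * (C₁ * M / √s) with hc
  have hexp1 : 0 ≤ 1 - Real.exp (-l * s) := by
    rw [sub_nonneg, Real.exp_le_one_iff]
    have := mul_pos hl h0
    linarith
  have hpt : ∀ t ∈ Ioi (0 : ℝ), ‖V t - F (t + s)‖
      ≤ √2 * M * (s / (√t * (t + s))) + Real.exp (-l * t) * c := by
    intro t ht
    rw [mem_Ioi] at ht
    have hts : 0 < t + s := by linarith
    have h1 := norm_transition_gradient_sub_le e hlam hs h0 ht hf hM x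
    have h2 := norm_gradT_le e hlam hs hf hM (t + s) x
    have e1 : Real.exp (-l * (t + s)) = Real.exp (-l * t) * Real.exp (-l * s) := by
      rw [← Real.exp_add]; congr 1; ring
    have hle1 : Real.exp (-l * t) ≤ 1 := by
      rw [Real.exp_le_one_iff]
      have := mul_pos hl ht
      linarith
    rw [← gradT_of_pos e ht, ← gradT_of_pos e (add_pos h0 ht), add_comm s t] at h1
    have e2 : V t - F (t + s) = Real.exp (-l * t) •
        ((transition e lam s (gradT e lam f t) x - gradT e lam f (t + s) x)
          + (1 - Real.exp (-l * s)) • gradT e lam f (t + s) x) := by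
      simp only [hVdef, hF]
      rw [e1]
      module
    rw [e2, norm_smul, Real.norm_of_nonneg (Real.exp_nonneg _)]
    have h3 : ‖(1 - Real.exp (-l * s)) • gradT e lam f (t + s) x‖ ≤ c := by
      rw [norm_smul, Real.norm_of_nonneg hexp1]
      refine mul_le_mul_of_nonneg_left (h2.trans ?_) hexp1
      exact div_le_div_of_nonneg_left (mul_nonneg C₁_nonneg hM0) hss
        (Real.sqrt_le_sqrt (by linarith))
    have h4 : 0 ≤ √2 * M * (s / (√t * (t + s))) := by positivity
    calc Real.exp (-l * t) * ‖(transition e lam s (gradT e lam f t) x - gradT e lam f (t + s) x)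
          + (1 - Real.exp (-l * s)) • gradT e lam f (t + s) x‖
        ≤ Real.exp (-l * t) * (√2 * M * (s / (√t * (t + s))) + c) := by
          refine mul_le_mul_of_nonneg_left ((norm_add_le _ _).trans (add_le_add ?_ h3))
            (Real.exp_nonneg _)
          linarith
      _ ≤ √2 * M * (s / (√t * (t + s))) + Real.exp (-l * t) * c := by
          rw [mul_add]
          exact add_le_add_left (mul_le_of_le_one_left h4 hle1) _
  have hfar : ‖∫ t in Ioi 0, (V t - F (t + s))‖ ≤ √2 * M * (Real.pi * √s) + C₁ * M * √s := by
    have hb1 := hIint.const_mul (√2 * M)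
    have hb2 := (integrableOn_exp_neg_mul hl).mul_const c
    calc ‖∫ t in Ioi 0, (V t - F (t + s))‖
        ≤ ∫ t in Ioi 0, (√2 * M * (s / (√t * (t + s))) + Real.exp (-l * t) * c) := by
          refine norm_integral_le_of_norm_le (hb1.add hb2) ?_
          filter_upwards [ae_restrict_mem measurableSet_Ioi] with t ht using hpt t ht
      _ = √2 * M * (Real.pi * √s) + 1 / l * c := by
          rw [integral_add hb1 hb2, integral_const_mul, integral_mul_const, hI,
            integral_exp_neg_mul hl]
      _ ≤ √2 * M * (Real.pi * √s) + C₁ * M * √s := by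
          refine add_le_add_right ?_ _
          have h1 : 1 - Real.exp (-l * s) ≤ l * s := by
            have := Real.add_one_le_exp (-l * s)
            linarith
          have h2 : 0 ≤ C₁ * M / √s := div_nonneg (mul_nonneg C₁_nonneg hM0) hss.le
          calc 1 / l * c ≤ 1 / l * (l * s * (C₁ * M / √s)) := by
                refine mul_le_mul_of_nonneg_left ?_ (by positivity)
                exact mul_le_mul_of_nonneg_right h1 h2
            _ = C₁ * M * (s / √s) := by field_simp
            _ = C₁ * M * √s := by rw [Real.div_sqrt]
  rw [hdiff]
  calc ‖(∫ t in Ioi 0, (V t - F (t + s))) - ∫ t in Ioc 0 s, F t‖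
      ≤ (√2 * M * (Real.pi * √s) + C₁ * M * √s) + 2 * (C₁ * M) * √s :=
        (norm_sub_le _ _).trans (add_le_add hfar hnear)
    _ = (√2 * Real.pi + 3 * C₁) * √s * M := by ring

end Positive

end Resolvent

/-! ### The eigenvalues of `A` -/

/-- A trace class operator has an absolutely convergent trace: bound
`∑ₖ |⟪e_k, T e_k⟫|` by `∑ₙ ‖aₙ‖ ‖bₙ‖`, by Bessel's inequality and Cauchy-Schwarz. -/
theorem IsTraceClass.summable_inner {H : Type*} [NormedAddCommGroup H] [InnerProductSpace ℝ H]
    {T : H →L[ℝ] H} (hT : IsTraceClass T) (e : HilbertBasis ℕ ℝ H) :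
    Summable fun k => inner ℝ (e k) (T (e k)) := by
  obtain ⟨a, b, hab, hT⟩ := hT
  have hk : ∀ k, HasSum (fun n => inner ℝ (a n) (e k) * inner ℝ (e k) (b n))
      (inner ℝ (e k) (T (e k))) := by
    intro k
    simpa [real_inner_smul_right] using (hT (e k)).mapL (innerSL ℝ (e k))
  have hrow : ∀ n, Summable (fun k => ‖inner ℝ (a n) (e k) * inner ℝ (e k) (b n)‖) ∧
      ∑' k, ‖inner ℝ (a n) (e k) * inner ℝ (e k) (b n)‖ ≤ ‖a n‖ * ‖b n‖ := by
    intro n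
    have h1 : ∀ N : Finset ℕ, ∑ k ∈ N, ‖inner ℝ (a n) (e k) * inner ℝ (e k) (b n)‖
        ≤ ‖a n‖ * ‖b n‖ := by
      intro N
      have h2 : ∀ v : H, ∑ k ∈ N, |inner ℝ (e k) v| ^ 2 ≤ ‖v‖ ^ 2 := fun v => by
        simpa using sum_le_hasSum N (fun k _ => sq_nonneg _) (hasSum_inner_sq e v)
      calc ∑ k ∈ N, ‖inner ℝ (a n) (e k) * inner ℝ (e k) (b n)‖
          = ∑ k ∈ N, |inner ℝ (e k) (a n)| * |inner ℝ (e k) (b n)| := by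
            refine Finset.sum_congr rfl fun k _ => ?_
            rw [Real.norm_eq_abs, abs_mul, real_inner_comm]
        _ ≤ √(∑ k ∈ N, |inner ℝ (e k) (a n)| ^ 2) * √(∑ k ∈ N, |inner ℝ (e k) (b n)| ^ 2) :=
            Real.sum_mul_le_sqrt_mul_sqrt _ _ _
        _ ≤ ‖a n‖ * ‖b n‖ := by
            refine mul_le_mul ?_ ?_ (Real.sqrt_nonneg _) (norm_nonneg _)
            · exact Real.sqrt_le_iff.2 ⟨norm_nonneg _, h2 _⟩
            · exact Real.sqrt_le_iff.2 ⟨norm_nonneg _, h2 _⟩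
    have h3 := summable_of_sum_le (fun k => norm_nonneg _) h1
    exact ⟨h3, h3.tsum_le_of_sum_le h1⟩
  have hprod : Summable fun p : ℕ × ℕ => inner ℝ (a p.1) (e p.2) * inner ℝ (e p.2) (b p.1) := by
    refine Summable.of_norm ?_
    rw [summable_prod_of_nonneg fun p => norm_nonneg _]
    exact ⟨fun n => (hrow n).1, Summable.of_nonneg_of_le
      (fun n => tsum_nonneg fun k => norm_nonneg _) (fun n => (hrow n).2) hab⟩
  have := hprod.prod_symm.prod
  simpa only [Prod.swap_prod_mk, (hk _).tsum_eq] using this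

section Eigenvalues

variable {H : Type*} [NormedAddCommGroup H] [InnerProductSpace ℝ H] [CompleteSpace H]
  {A : H →ₗ.[ℝ] H} {ω : ℝ} {e : HilbertBasis ℕ ℝ H} {lam : ℕ → ℝ}

theorem IsEigenbasis.le_eigenvalue (he : IsEigenbasis A e lam) (hA : IsNegTraceClassInv A ω)
    (k : ℕ) : ω ≤ lam k := by
  obtain ⟨hk, hk'⟩ := he k
  have h := hA.neg ⟨e k, hk⟩
  rw [hk', real_inner_smul_left, real_inner_self_eq_norm_sq, e.orthonormal.1 k] at h
  linarith

theorem IsEigenbasis.summable_inv (he : IsEigenbasis A e lam) (hA : IsNegTraceClassInv A ω) :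
    Summable fun k => (lam k)⁻¹ := by
  obtain ⟨G, hG, -, hGl⟩ := hA.traceClass_inv
  have h := (hG.summable_inner e).neg
  refine h.congr fun k => ?_
  obtain ⟨hk, hk'⟩ := he k
  have h1 := hGl ⟨e k, hk⟩
  have hlam : lam k ≠ 0 := (hA.pos.trans_le (he.le_eigenvalue hA k)).ne'
  rw [hk', map_smul] at h1
  have h2 : G (e k) = -(lam k)⁻¹ • e k := by
    change -lam k • G (e k) = e k at h1
    have h3 : -(lam k)⁻¹ * -lam k = 1 := by rw [neg_mul_neg, inv_mul_cancel₀ hlam]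
    calc G (e k) = (-(lam k)⁻¹ * -lam k) • G (e k) := by rw [h3, one_smul]
      _ = -(lam k)⁻¹ • e k := by rw [mul_smul, h1]
  rw [h2, real_inner_smul_right, real_inner_self_eq_norm_sq, e.orthonormal.1 k]
  simp

end Eigenvalues

/-! ### Removal of the drift -/

section Center

variable {H : Type*} [NormedAddCommGroup H] [InnerProductSpace ℝ H] [CompleteSpace H]
  (e : HilbertBasis ℕ ℝ H) {lam : ℕ → ℝ} {ω : ℝ}

/-- The vector `(-A)^{-1/2} z`. -/
noncomputable def center (lam : ℕ → ℝ) (z : H) : H := diagOp e (fun k => 1 / √(lam k)) z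

theorem drift_eq (hω : 0 < ω) (hle : ∀ k, ω ≤ lam k) (z : H) {t : ℝ} (ht : 0 ≤ t) :
    drift e lam t z = center e lam z - semigroup e lam t (center e lam z) := by
  have hlam : ∀ k, 0 < lam k := fun k => hω.trans_le (hle k)
  have hc : ∀ k, |1 / √(lam k)| ≤ 1 / √ω := fun k => by
    rw [abs_of_nonneg (by positivity)]
    exact one_div_le_one_div_of_le (Real.sqrt_pos.2 hω) (Real.sqrt_le_sqrt (hle k))
  have hd : ∀ k, |(1 - Real.exp (-lam k * t)) / √(lam k)| ≤ 1 / √ω := fun k => by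
    have h1 : 0 ≤ 1 - Real.exp (-lam k * t) :=
      sub_nonneg.2 ((le_abs_self _).trans (abs_exp_neg_mul_le_one hlam ht k))
    rw [abs_of_nonneg (by positivity)]
    exact div_le_div₀ zero_le_one (by linarith [Real.exp_pos (-lam k * t)]) (Real.sqrt_pos.2 hω)
      (Real.sqrt_le_sqrt (hle k))
  refine ext_inner_basis e fun k => ?_
  rw [drift, inner_diagOp e hd, inner_sub_right, semigroup,
    inner_diagOp e (abs_exp_neg_mul_le_one hlam ht), center, inner_diagOp e hc]
  ring

end Center

section Drift

variable {H : Type*} [NormedAddCommGroup H] [InnerProductSpace ℝ H] [CompleteSpace H]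
  [MeasurableSpace H] (e : HilbertBasis ℕ ℝ H) {lam : ℕ → ℝ} {ω : ℝ}

/-- Translation by `a = (-A)^{-1/2} z` removes the drift, because `Γ_t z = a - e^{tA} a`. -/
theorem P_eq_transition (hω : 0 < ω) (hle : ∀ k, ω ≤ lam k) (z : H) {t : ℝ} (ht : 0 ≤ t)
    {E : Type*} [NormedAddCommGroup E] [NormedSpace ℝ E] (f : H → E) (x : H) :
    P e lam z t f x
      = transition e lam t (fun y => f (y + center e lam z)) (x - center e lam z) := by
  have hlam : ∀ k, 0 < lam k := fun k => hω.trans_le (hle k)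
  have h1 : semigroup e lam t x
      = semigroup e lam t (x - center e lam z) + semigroup e lam t (center e lam z) := by
    rw [← semigroup_add e hlam ht, sub_add_cancel]
  rw [P, transition]
  congr 1
  funext y
  rw [drift_eq e hω hle z ht, h1]
  congr 1
  abel

theorem resolvent_eq (hω : 0 < ω) (hle : ∀ k, ω ≤ lam k) (z : H) (l : ℝ) (f : H → ℝ) :
    resolvent e lam z l f = fun x =>
      resolvent₀ e lam l (fun y => f (y + center e lam z)) (x - center e lam z) := by
  funext x
  refine setIntegral_congr_fun measurableSet_Ioi fun t ht => ?_
  rw [P_eq_transition e hω hle z (le_of_lt ht)]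

end Drift

theorem abs_le_supNorm {H : Type*} [NormedAddCommGroup H] {f : H → ℝ} (hfb : ∃ M, ∀ x, |f x| ≤ M)
    (x : H) : |f x| ≤ supNorm f := by
  obtain ⟨M, hM⟩ := hfb
  exact le_ciSup (f := fun x => |f x|) ⟨M, by rintro _ ⟨y, rfl⟩; exact hM y⟩ x

/-- The factor depending on `ω` in `C₂` is at least `1`, which is all that is used of it. -/
theorem le_C₂ {ω : ℝ} (hω : 0 < ω) : √2 * Real.pi + 3 * C₁ ≤ C₂ ω := by
  have h1 : 1 ≤ √(1 + ω) / √ω := by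
    rw [one_le_div (Real.sqrt_pos.2 hω)]
    exact Real.sqrt_le_sqrt (by linarith)
  have h2 : √2 * Real.pi ≤ √2 * Real.pi * (√(1 + ω) / √ω) :=
    le_mul_of_one_le_right (by positivity) h1
  have := C₁_nonneg
  rw [C₂]
  linarith

end OU

theorem theorem3p4 {H : Type*} [NormedAddCommGroup H] [InnerProductSpace ℝ H] [CompleteSpace H]
    [MeasurableSpace H] [BorelSpace H]
    (A : H →ₗ.[ℝ] H) (ω : ℝ) (hA : OU.IsNegTraceClassInv A ω)
    (e : HilbertBasis ℕ ℝ H) (lam : ℕ → ℝ) (he : OU.IsEigenbasis A e lam)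
    (f : H → ℝ) (hf : Measurable f) (hfb : ∃ M, ∀ x, |f x| ≤ M)
    (l : ℝ) (hl : 0 < l) (z : H) :
    (∀ x, IntegrableOn (fun t => Real.exp (-l * t) * OU.P e lam z t f x) (Ioi 0)) ∧
    ContDiff ℝ 1 (OU.resolvent e lam z l f) ∧
    (∃ M, ∀ x, |OU.resolvent e lam z l f x| ≤ M ∧ ‖gradient (OU.resolvent e lam z l f) x‖ ≤ M) ∧
    ∀ s ∈ Icc (0 : ℝ) 1, ∀ x : H,
      ‖OU.P e lam z s (gradient (OU.resolvent e lam z l f)) x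
          - gradient (OU.resolvent e lam z l f) x‖
        ≤ OU.C₂ ω * √s * OU.supNorm f := by
  have hω := hA.pos
  have hle := he.le_eigenvalue hA
  have hlam : ∀ k, 0 < lam k := fun k => hω.trans_le (hle k)
  have hs := he.summable_inv hA
  set a := OU.center e lam z with ha
  set g : H → ℝ := fun y => f (y + a) with hg
  have hgm : Measurable g := hf.comp (measurable_id.add_const a)
  have hgM : ∀ x, |g x| ≤ OU.supNorm f := fun x => OU.abs_le_supNorm hfb _
  have hM0 : 0 ≤ OU.supNorm f := (abs_nonneg _).trans (hgM 0)
  have hres := OU.resolvent_eq e hω hle z l f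
  have hgrad : ∀ x, HasGradientAt (OU.resolvent e lam z l f)
      (OU.resolventGrad e lam l g (x - a)) x := by
    intro x
    have h := (OU.hasGradientAt_resolvent₀ e hlam hs hgm hgM hl (x - a)).hasFDerivAt
    rw [hasGradientAt_iff_hasFDerivAt, hres]
    exact (h.comp x ((hasFDerivAt_id x).sub_const a)).congr_fderiv
      (ContinuousLinearMap.comp_id _)
  have hgrad' : gradient (OU.resolvent e lam z l f)
      = fun x => OU.resolventGrad e lam l g (x - a) := funext fun x => (hgrad x).gradient
  have hcont : Continuous (OU.resolventGrad e lam l g) :=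
    OU.continuous_resolventGrad e hlam hs hgm hgM hl
  refine ⟨fun x => ?_, ?_, ?_, ?_⟩
  · refine (OU.integrableOn_exp_mul_transition (lam := lam) e hgm hgM hl (x - a)).congr_fun
      (fun t ht => ?_) measurableSet_Ioi
    simp only
    rw [OU.P_eq_transition e hω hle z (le_of_lt ht)]
  · rw [contDiff_one_iff_fderiv]
    refine ⟨fun x => (hgrad x).differentiableAt, ?_⟩
    rw [← toDual_comp_gradient, hgrad']
    exact (InnerProductSpace.toDual ℝ H).continuous.comp
      (hcont.comp (continuous_id.sub continuous_const))
  · refine ⟨max (1 / l * OU.supNorm f)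
      (∫ t in Ioi 0, Real.exp (-l * t) * (OU.C₁ * OU.supNorm f / √t)), fun x => ⟨?_, ?_⟩⟩
    · rw [hres]
      exact (OU.abs_resolvent₀_le e hgM hl _).trans (le_max_left _ _)
    · rw [hgrad']
      exact (OU.norm_resolventGrad_le e hlam hs hgm hgM hl _).trans (le_max_right _ _)
  · rintro s ⟨h0, -⟩ x
    rw [OU.P_eq_transition e hω hle z h0, hgrad']
    simp only [add_sub_cancel_right, ← ha]
    have hC : 0 ≤ OU.C₂ ω :=
      le_trans (by have := OU.C₁_nonneg; positivity) (OU.le_C₂ hω)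
    -- at `s = 0` the measure `N(0, Q_s)` degenerates to the point mass at `0`
    rcases h0.eq_or_lt with rfl | hpos
    · have := OU.separableSpace_of_hilbertBasis e
      have : SecondCountableTopology H := UniformSpace.secondCountable_of_separable H
      rw [OU.transition_zero e _ hcont.stronglyMeasurable]
      simp
    · refine (OU.norm_transition_resolventGrad_sub_le e hlam hs hgm hgM hl hpos _).trans ?_
      exact mul_le_mul_of_nonneg_right
        (mul_le_mul_of_nonneg_right (OU.le_C₂ hω) (Real.sqrt_nonneg _)) hM0
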